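/- Let $m \ge 0$, let $\mu=(\mu_1\ge\mu_2\ge\cdots\ge\mu_m)$ be a tuple of non-negative integers with $N=\sum_i\mu_i$, let $\lambda$ be a partition of $N$, and let $\tau$ be a semistandard Young tableau of shape $\lambda$ and weight $\mu$, that is, with entries in $\{1,\dots,m\}$ and with exactly $\mu_i$ entries equal to $i$ for each $i$. For $1\le i\le m$ let $\lambda^{(i)}$ be the shape of the tableau obtained from $\tau$ by deleting all entries $j>i$. For a partition $\nu$ of $n$ let $J_\nu$ be the nilpotent $n\times n$ complex Jordan matrix with block sizes $\nu_1,\nu_2,\dots$ and ones on the superdiagonal of each block, and let $\mathbb O_\nu$ be its conjugacy class under $GL_n(\mathbb C)$. Likewise let $J_\mu$ be the $N\times N$ Jordan matrix with block sizes $\mu_1,\dots,\mu_m$. Let $\mathbb T_\mu$ be the set of matrices $J_\mu+T$, where $T$ is an $N\times N$ complex matrix, divided into blocks of sizes $\mu_i\times\mu_j$, all of whose entries vanish except perhaps those in the first $\min(\mu_i,\mu_j)$ columns of the last row of the $(i,j)$ block, $1\le i,j\le m$. Let $\mathfrak n$ be the set of upper-triangular $N\times N$ matrices, and let $$X_\tau=\{A\in\mathbb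 T_\mu\cap\mathfrak n : A^{(i)}\in\mathbb O_{\lambda^{(i)}}\text{ for }1\le i\le m\},$$ where $A^{(i)}$ is the top left $N_i\times N_i$ submatrix of $A$, $N_i=\mu_1+\cdots+\mu_i$. Give $X_\tau$ the topology induced from the Zariski topology of the affine space of $N\times N$ complex matrices. Then $X_\tau$ has exactly one irreducible component $X_\tau^d$ of maximal dimension: there is an irreducible component $X_\tau^d$ of dimension $d$ such that every other irreducible component has dimension smaller than $d$. Moreover $$d=\langle\lambda-\mu,\rho\rangle=\sum_{i=1}^m(\lambda_i-\mu_i)(m+1-i),$$ where $\rho=(m,m-1,\dots,1)$ and $\lambda$ is read as a vector with $m$ entries by appending zeros (it has at most $m$ non-zero parts). -/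

import Mathlib

namespace MVSlice

/-! ### Matrices and the Zariski topology -/

/-- The Zariski topology on the affine space of `n × n` complex matrices: the closed sets are the
common zero sets of families of polynomials in the matrix entries. -/
@[reducible] def zariskiTopology (n : Type) : TopologicalSpace (Matrix n n ℂ) :=
  TopologicalSpace.ofClosed
    {Z | ∃ S : Set (MvPolynomial (n × n) ℂ),
      Z = {A | ∀ f ∈ S, MvPolynomial.eval (fun p : n × n => A p.1 p.2) f = 0}}
    ⟨{1}, by ext A; simp⟩
    (by
      intro C hC
      refine ⟨{f | ∀ A ∈ ⋂₀ C, MvPolynomial.eval (fun p : n × n => A p.1 p.2) f = 0}, ?_⟩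
      ext A
      constructor
      · intro hA f hf
        exact hf A hA
      · intro hA Z hZ
        obtain ⟨S, rfl⟩ := hC hZ
        intro f hf
        exact hA f fun B hB => hB _ hZ f hf)
    (by
      rintro _ ⟨S, rfl⟩ _ ⟨S', rfl⟩
      refine ⟨{h | ∃ f ∈ S, ∃ g ∈ S', h = f * g}, ?_⟩
      ext A
      constructor
      · rintro (hA | hA) _ ⟨f, hf, g, hg, rfl⟩
        · rw [map_mul, hA f hf, zero_mul]
        · rw [map_mul, hA g hg, mul_zero]
      · intro hA
        by_contra hcon
        simp only [Set.mem_union, Set.mem_ofPred_eq, not_or, not_forall] at hcon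
        obtain ⟨⟨f, hf, hf0⟩, ⟨g, hg, hg0⟩⟩ := hcon
        have h := hA (f * g) ⟨f, hf, g, hg, rfl⟩
        rw [map_mul] at h
        exact (mul_ne_zero hf0 hg0) h)

/-- The index set of a basis of `ℂ^N`, `N = ν_1 + ⋯ + ν_l`, enumerated by blocks: the pair
`⟨i, k⟩` stands for the basis vector `e_i^k` (all indices counted from `0`). -/
abbrev Box {l : ℕ} (ν : Fin l → ℕ) : Type := Σ i : Fin l, Fin (ν i)

/-- The nilpotent Jordan matrix with blocks of sizes `ν_1, …, ν_l`, ones on the superdiagonal of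
each block. -/
def jordan {l : ℕ} (ν : Fin l → ℕ) : Matrix (Box ν) (Box ν) ℂ :=
  fun p q => if p.1 = q.1 ∧ (p.2 : ℕ) + 1 = (q.2 : ℕ) then 1 else 0

/-- The rows of a Young diagram, as a tuple of positive integers. -/
def rows (lam : YoungDiagram) : Fin (lam.colLen 0) → ℕ := fun i => lam.rowLen i

/-- The conjugacy class `𝕆_λ` of the Jordan normal form `J_λ`, among matrices whose rows and columns
are indexed by an arbitrary finite type `n` (it is empty unless `n` has `|λ|` elements). Any
identification of the index set of `J_λ` with `n` gives the same class. -/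
def orbit (n : Type) [Fintype n] [DecidableEq n] (lam : YoungDiagram) : Set (Matrix n n ℂ) :=
  {A | ∃ (e : Box (rows lam) ≃ n) (g : (Matrix n n ℂ)ˣ),
    A = (g : Matrix n n ℂ) * Matrix.reindex e e (jordan (rows lam)) *
      ((g⁻¹ : (Matrix n n ℂ)ˣ) : Matrix n n ℂ)}

/-- The Mirković–Vybornov slice `𝕋_μ`: matrices `J_μ + T`, where `T` vanishes except perhaps in the
first `min (μ_i, μ_j)` columns of the last row of the `(i, j)` block. -/
def slice {m : ℕ} (μ : Fin m → ℕ) : Set (Matrix (Box μ) (Box μ) ℂ) :=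
  {A | ∃ T : Matrix (Box μ) (Box μ) ℂ, A = jordan μ + T ∧
    ∀ p q : Box μ,
      ¬ ((p.2 : ℕ) + 1 = μ p.1 ∧ (q.2 : ℕ) < min (μ p.1) (μ q.1)) → T p q = 0}

/-- The upper-triangular matrices, for the order `e_1^1, …, e_1^{μ_1}, …, e_m^1, …, e_m^{μ_m}` of
the basis. -/
def upperTriangular {m : ℕ} (μ : Fin m → ℕ) : Set (Matrix (Box μ) (Box μ) ℂ) :=
  {A | ∀ p q : Box μ, (q.1 < p.1 ∨ (q.1 = p.1 ∧ (q.2 : ℕ) < (p.2 : ℕ))) → A p q = 0}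

/-- The top left submatrix of `A` formed by the blocks `1, …, i`. For upper-triangular `A` it is the
matrix of the restriction of `A` to the span `V^{(i)}` of the basis vectors in these blocks. -/
def restrict {m : ℕ} {μ : Fin m → ℕ} (A : Matrix (Box μ) (Box μ) ℂ) (i : Fin m) :
    Matrix {p : Box μ // p.1 ≤ i} {p : Box μ // p.1 ≤ i} ℂ :=
  A.submatrix Subtype.val Subtype.val

/-! ### Tableaux -/

/-- The semistandard tableau `τ` has its entries in the alphabet `{0, …, m - 1}` (the alphabet
`{1, …, m}`, shifted by one), and each letter `i` occurs exactly `μ i` times. -/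
def HasWeight {lam : YoungDiagram} (τ : SemistandardYoungTableau lam) {m : ℕ} (μ : Fin m → ℕ) :
    Prop :=
  (∀ c ∈ lam.cells, τ c.1 c.2 < m) ∧
    ∀ i : Fin m, (lam.cells.filter fun c => τ c.1 c.2 = (i : ℕ)).card = μ i

/-- The shape of the tableau obtained from `τ` by deleting all letters `j > i`. -/
def shapeUpTo {lam : YoungDiagram} (τ : SemistandardYoungTableau lam) (i : ℕ) : YoungDiagram where
  cells := lam.cells.filter fun c => τ c.1 c.2 ≤ i
  isLowerSet := by
    rintro ⟨a, b⟩ ⟨a', b'⟩ hle h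
    obtain ⟨ha, hb⟩ : a' ≤ a ∧ b' ≤ b := hle
    simp only [Finset.coe_filter, Set.mem_ofPred_eq, YoungDiagram.mem_cells] at h ⊢
    refine ⟨lam.up_left_mem ha hb h.1, ?_⟩
    have h1 : τ a' b' ≤ τ a' b := τ.row_weak_of_le hb (lam.up_left_mem ha le_rfl h.1)
    have h2 : τ a' b ≤ τ a b := τ.col_weak ha h.1
    exact h1.trans (h2.trans h.2)

/-! ### The variety of a tableau -/

/-- The set `X_τ` of all `A ∈ 𝕋_μ ∩ 𝔫` such that, for each letter `i`, the restriction of `A` to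
`V^{(i)}` lies in `𝕆_{λ^{(i)}}`, where `λ^{(i)}` is the shape of the part of `τ` with letters
at most `i`. -/
def tableauSet {lam : YoungDiagram} (τ : SemistandardYoungTableau lam) {m : ℕ} (μ : Fin m → ℕ) :
    Set (Matrix (Box μ) (Box μ) ℂ) :=
  {A | A ∈ slice μ ∩ upperTriangular μ ∧
    ∀ i : Fin m, restrict A i ∈ orbit {p : Box μ // p.1 ≤ i} (shapeUpTo τ i)}

/-- `X_τ` as a space, to be equipped with the Zariski topology. -/
def TableauVariety {lam : YoungDiagram} (τ : SemistandardYoungTableau lam) {m : ℕ}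
    (μ : Fin m → ℕ) : Type :=
  {A : Matrix (Box μ) (Box μ) ℂ // A ∈ tableauSet τ μ}

/-- The Zariski topology of `X_τ`, induced from the affine space of matrices. -/
instance {lam : YoungDiagram} (τ : SemistandardYoungTableau lam) {m : ℕ} (μ : Fin m → ℕ) :
    TopologicalSpace (TableauVariety τ μ) :=
  (zariskiTopology (Box μ)).induced Subtype.val

/-- The vector `ρ = (m, m - 1, …, 1)`. -/
def rho (m : ℕ) : Fin m → ℤ := fun i => (m : ℤ) - (i : ℕ)

/-- The pairing `⟨λ - μ, ρ⟩`, with `λ` read as a vector with `m` entries. -/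
def pairing (lam : YoungDiagram) {m : ℕ} (μ : Fin m → ℕ) : ℤ :=
  ∑ i : Fin m, ((lam.rowLen i : ℤ) - (μ i : ℤ)) * rho m i

end MVSlice

/-!
The variety of a tableau `τ` is irreducible, so that it is its own only irreducible component, and
it is covered by open sets isomorphic to open subsets of affine space of the asserted dimension.
Both facts are proved by induction on the number of letters: deleting the last letter of the
tableau and the last block of the matrix gives a map between varieties of tableaux, and this map
is, locally on its target, the projection of an open subset of a vector bundle, with non-empty
fibres (`isLocallyOpenInBundle_stage`). Such a map transports irreducibility
(`isIrreducible_of_isLocallyOpenInBundle`) and affine charts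
(`LocallyAffine.of_isLocallyOpenInBundle`) from its target to its source.

Points of the fibre. A matrix of the variety is strictly upper triangular, because its diagonal is
zero outside the last rows of the blocks, and the traces of its nilpotent top left blocks vanish.
So the free entries of the `j`-th block of columns (counted from `0`) are those in the last rows of
the `j` blocks above the diagonal one, `j * μ j` in number. Let `A` and `B` be the top left blocks
for `j` and `j + 1` letters. The matrix `B` is an extension of `A` by a cyclic nilpotent matrix:
with `x` the last basis vector of the `j`-th block and `k = μ j`, the vector `B ^ k x` lies in the
space on which `A` acts, and this vector `w` depends linearly on the free entries. The conjugacy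
class of a nilpotent matrix is determined by the ranks of its powers (`mem_orbit_iff`), and the
rank of `B ^ r` tells whether `A ^ s w` is in the range of `A ^ r`, where `r ≤ k + s`
(`IsCyclicExtension.finrank_range_le_iff`).

Let `κ ⊆ λ` be the shapes for `j` and `j + 1` letters, and let `D r` be the number of boxes of the
horizontal strip `λ / κ` in the first `r` columns. In coordinates where `A` is the Jordan matrix of
`κ`, the inequalities `rank (B ^ r) ≤ rank (J_λ ^ r)` for all `r` say that in the block of size
`κ_i` the last `D (κ_i)` coordinates of `w` vanish (`IsStripExtension.rank_le_colTail_iff`). These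
are linear equations, and they are independent as equations for the free entries, because every
vector is a value of `w` modulo the range of `A ^ k` (`exists_extMat_mulVec`); this step uses that
`μ` decreases. Their number is `∑ D (κ_i) = ∑ i * (λ_i - κ_i)`. The opposite inequalities for the
ranks are open conditions, and they hold if none of the other relevant coordinates vanishes
(`IsStripExtension.colTail_le_rank`). Hence the fibre is a non-empty open subset of a vector space
of dimension `j * μ j - ∑ i * (λ_i - κ_i)`. Summing over the letters gives `∑ i * μ i - ∑ i * λ_i`,
which is the pairing of `λ - μ` and `ρ`, since `∑ λ_i = ∑ μ i`.

To see that these vector spaces form a vector bundle, one needs a matrix that brings `A` into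
Jordan form and depends regularly on `A`, locally on a conjugacy class
(`exists_regular_conjugation`). It is found, like the local frames of the bundle itself, by solving
a system of linear equations with regular coefficients and constant rank
(`exists_regular_kernel_basis`).
-/

namespace MVSlice

open Topology TopologicalSpace
open scoped Matrix

/-! ### Affine space and regular functions -/

section AffineSpace

/-- The affine space with coordinates indexed by `σ`. It is kept apart from `σ → ℂ`, so that it
can carry the Zariski topology instead of the product topology. -/
@[ext] structure Aff (σ : Type) where
  /-- The coordinates of a point. -/
  toFun : σ → ℂ

instance (σ : Type) : CoeFun (Aff σ) fun _ => σ → ℂ := ⟨Aff.toFun⟩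

variable {σ τ ι : Type}

/-- The point of the prime spectrum of the polynomial ring given by the polynomials vanishing
at `x`. -/
noncomputable def toSpec (x : Aff σ) : PrimeSpectrum (MvPolynomial σ ℂ) :=
  ⟨RingHom.ker (MvPolynomial.eval x.toFun), RingHom.ker_isPrime _⟩

/-- The value of a polynomial at a point of affine space. -/
noncomputable def ev (f : MvPolynomial σ ℂ) (x : Aff σ) : ℂ := MvPolynomial.eval x.toFun f

/-- The Zariski topology on affine space. -/
noncomputable instance : TopologicalSpace (Aff σ) := .induced toSpec inferInstance

@[simp] lemma ev_add (f g : MvPolynomial σ ℂ) (x : Aff σ) : ev (f + g) x = ev f x + ev g x :=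
  map_add _ _ _

@[simp] lemma ev_sub (f g : MvPolynomial σ ℂ) (x : Aff σ) : ev (f - g) x = ev f x - ev g x :=
  map_sub _ _ _

@[simp] lemma ev_mul (f g : MvPolynomial σ ℂ) (x : Aff σ) : ev (f * g) x = ev f x * ev g x :=
  map_mul _ _ _

@[simp] lemma ev_one (x : Aff σ) : ev 1 x = 1 := map_one _

@[simp] lemma ev_C (c : ℂ) (x : Aff σ) : ev (MvPolynomial.C c) x = c := MvPolynomial.eval_C _

@[simp] lemma ev_X (i : σ) (x : Aff σ) : ev (MvPolynomial.X i) x = x i := MvPolynomial.eval_X _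

lemma isOpen_iff_ev {U : Set (Aff σ)} :
    IsOpen U ↔ ∀ x ∈ U, ∃ f, ev f x ≠ 0 ∧ ∀ y, ev f y ≠ 0 → y ∈ U := by
  have hb := (PrimeSpectrum.isTopologicalBasis_basic_opens
    (R := MvPolynomial σ ℂ)).induced (toSpec (σ := σ))
  rw [hb.isOpen_iff]
  constructor
  · intro h x hx
    obtain ⟨_, ⟨_, ⟨f, rfl⟩, rfl⟩, hxf, hU⟩ := h x hx
    exact ⟨f, hxf, fun y hy => hU hy⟩
  · intro h x hx
    obtain ⟨f, hxf, hU⟩ := h x hx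
    exact ⟨_, ⟨_, ⟨f, rfl⟩, rfl⟩, hxf, fun y hy => hU y hy⟩

lemma isOpen_ev_ne_zero (f : MvPolynomial σ ℂ) : IsOpen {x | ev f x ≠ 0} :=
  isOpen_iff_ev.2 fun _ hx => ⟨f, hx, fun _ hy => hy⟩

/-- A function on affine space is regular on `S` if it is there a single fraction of polynomials
whose denominator has no zero on `S`. -/
def RegularOn (S : Set (Aff σ)) (F : Aff σ → ℂ) : Prop :=
  ∃ p q, ∀ x ∈ S, ev q x ≠ 0 ∧ F x = ev p x / ev q x

/-- A map between affine spaces is regular on `S` if its coordinates are. -/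
def RegularMapOn (S : Set (Aff σ)) (G : Aff σ → Aff τ) : Prop :=
  ∀ i, RegularOn S fun x => G x i

namespace RegularOn

variable {S T : Set (Aff σ)} {F G : Aff σ → ℂ}

lemma mono (h : RegularOn T F) (hST : S ⊆ T) : RegularOn S F := by
  obtain ⟨p, q, H⟩ := h
  exact ⟨p, q, fun x hx => H x (hST hx)⟩

lemma congr (h : RegularOn S F) (hFG : ∀ x ∈ S, G x = F x) : RegularOn S G := by
  obtain ⟨p, q, H⟩ := h
  exact ⟨p, q, fun x hx => ⟨(H x hx).1, (hFG x hx).trans (H x hx).2⟩⟩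

lemma const (c : ℂ) : RegularOn S fun _ => c :=
  ⟨.C c, 1, fun x _ => by simp⟩

lemma coord (i : σ) : RegularOn S fun x => x i :=
  ⟨.X i, 1, fun x _ => by simp⟩

lemma add (hF : RegularOn S F) (hG : RegularOn S G) : RegularOn S fun x => F x + G x := by
  obtain ⟨p, q, H⟩ := hF
  obtain ⟨p', q', H'⟩ := hG
  refine ⟨p * q' + q * p', q * q', fun x hx => ?_⟩
  obtain ⟨h1, h2⟩ := H x hx
  obtain ⟨h1', h2'⟩ := H' x hx
  refine ⟨by simp [h1, h1'], ?_⟩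
  simp only [h2, h2', ev_add, ev_mul]
  exact div_add_div _ _ h1 h1'

lemma mul (hF : RegularOn S F) (hG : RegularOn S G) : RegularOn S fun x => F x * G x := by
  obtain ⟨p, q, H⟩ := hF
  obtain ⟨p', q', H'⟩ := hG
  refine ⟨p * p', q * q', fun x hx => ?_⟩
  obtain ⟨h1, h2⟩ := H x hx
  obtain ⟨h1', h2'⟩ := H' x hx
  refine ⟨by simp [h1, h1'], ?_⟩
  simp only [h2, h2', ev_mul]
  exact div_mul_div_comm _ _ _ _

lemma inv (hF : RegularOn S F) (h0 : ∀ x ∈ S, F x ≠ 0) : RegularOn S fun x => (F x)⁻¹ := by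
  obtain ⟨p, q, H⟩ := hF
  refine ⟨q, p, fun x hx => ?_⟩
  obtain ⟨h1, h2⟩ := H x hx
  have := h0 x hx
  rw [h2] at this
  refine ⟨fun h => this (by simp [h]), ?_⟩
  simp [h2]

lemma neg (hF : RegularOn S F) : RegularOn S fun x => - F x :=
  ((const (-1)).mul hF).congr fun x _ => by ring

lemma sub (hF : RegularOn S F) (hG : RegularOn S G) : RegularOn S fun x => F x - G x :=
  (hF.add hG.neg).congr fun x _ => by ring

lemma sum {κ : Type*} {F : κ → Aff σ → ℂ} (s : Finset κ) (h : ∀ k ∈ s, RegularOn S (F k)) :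
    RegularOn S fun x => ∑ k ∈ s, F k x := by
  classical
  induction s using Finset.induction_on with
  | empty => simpa using const 0
  | insert a s ha ih =>
    refine ((h a (by simp)).add (ih fun k hk => h k (by simp [hk]))).congr fun x _ => ?_
    rw [Finset.sum_insert ha]

lemma prod {κ : Type*} {F : κ → Aff σ → ℂ} (s : Finset κ) (h : ∀ k ∈ s, RegularOn S (F k)) :
    RegularOn S fun x => ∏ k ∈ s, F k x := by
  classical
  induction s using Finset.induction_on with
  | empty => simpa using const 1
  | insert a s ha ih =>
    refine ((h a (by simp)).mul (ih fun k hk => h k (by simp [hk]))).congr fun x _ => ?_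
    rw [Finset.prod_insert ha]

lemma ev_comp {G : Aff σ → Aff τ} (hG : RegularMapOn S G) (f : MvPolynomial τ ℂ) :
    RegularOn S fun x => ev f (G x) := by
  induction f using MvPolynomial.induction_on with
  | C a => simpa using const a
  | add p q hp hq => simpa using hp.add hq
  | mul_X p i hp => simpa using hp.mul (hG i)

lemma comp {T : Set (Aff τ)} {F : Aff τ → ℂ} {G : Aff σ → Aff τ} (hF : RegularOn T F)
    (hG : RegularMapOn S G) (hm : Set.MapsTo G S T) : RegularOn S fun x => F (G x) := by
  obtain ⟨p, q, H⟩ := hF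
  refine ((ev_comp hG p).mul ((ev_comp hG q).inv fun x hx => (H _ (hm hx)).1)).congr
    fun x hx => ?_
  rw [(H _ (hm hx)).2, div_eq_mul_inv]

/-- The nonvanishing locus of a regular function is relatively open. -/
lemma exists_poly_ne_zero (hF : RegularOn S F) : ∃ p, ∀ x ∈ S, F x ≠ 0 ↔ ev p x ≠ 0 := by
  obtain ⟨p, q, H⟩ := hF
  refine ⟨p, fun x hx => ?_⟩
  rw [(H x hx).2, ne_eq, div_eq_zero_iff, or_iff_left (H x hx).1]

end RegularOn

namespace RegularMapOn

variable {S T : Set (Aff σ)}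

lemma mono {G : Aff σ → Aff τ} (h : RegularMapOn T G) (hST : S ⊆ T) : RegularMapOn S G :=
  fun i => (h i).mono hST

lemma comp {T : Set (Aff τ)} {F : Aff τ → Aff ι} {G : Aff σ → Aff τ} (hF : RegularMapOn T F)
    (hG : RegularMapOn S G) (hm : Set.MapsTo G S T) : RegularMapOn S fun x => F (G x) :=
  fun i => (hF i).comp hG hm

lemma continuousOn {G : Aff σ → Aff τ} (h : RegularMapOn S G) : ContinuousOn G S := by
  rw [continuousOn_iff]
  intro x hx t ht hxt
  obtain ⟨f, hf, hft⟩ := isOpen_iff_ev.1 ht _ hxt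
  obtain ⟨p, hp⟩ := (RegularOn.ev_comp h f).exists_poly_ne_zero
  exact ⟨_, isOpen_ev_ne_zero p, (hp x hx).1 hf, fun y hy => hft _ ((hp y hy.2).2 hy.1)⟩

lemma continuous {G : Aff σ → Aff τ} (h : RegularMapOn Set.univ G) : Continuous G :=
  continuousOn_univ.1 h.continuousOn

end RegularMapOn

/-! ### Dimension and irreducibility -/

lemma ev_eq_zero_iff {f : MvPolynomial σ ℂ} : (∀ x, ev f x = 0) ↔ f = 0 :=
  ⟨fun h => MvPolynomial.funext fun x => by simpa [ev] using h ⟨x⟩, by rintro rfl; simp [ev]⟩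

instance : IrreducibleSpace (Aff σ) where
  isPreirreducible_univ := by
    intro u v hu hv ⟨x, _, hx⟩ ⟨y, _, hy⟩
    obtain ⟨f, hf, hfu⟩ := isOpen_iff_ev.1 hu x hx
    obtain ⟨g, hg, hgv⟩ := isOpen_iff_ev.1 hv y hy
    have h : ¬ ∀ z, ev (f * g) z = 0 := by
      rw [ev_eq_zero_iff, mul_eq_zero, ← ev_eq_zero_iff, ← ev_eq_zero_iff]
      rintro (h | h)
      exacts [hf (h x), hg (h y)]
    push Not at h
    obtain ⟨z, hz⟩ := h
    rw [ev_mul, mul_ne_zero_iff] at hz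
    exact ⟨z, trivial, hfu z hz.1, hgv z hz.2⟩
  toNonempty := ⟨⟨fun _ => 0⟩⟩

lemma topologicalKrullDim_aff_le [Fintype ι] :
    topologicalKrullDim (Aff ι) ≤ Fintype.card ι := by
  refine (IsInducing.induced toSpec).topologicalKrullDim_le.trans ?_
  rw [PrimeSpectrum.topologicalKrullDim_eq_ringKrullDim,
    MvPolynomial.ringKrullDim_of_isNoetherianRing, ringKrullDim_eq_zero_of_field]
  simp

/-- The flag of coordinate subspaces through a point of `W`, intersected with `W`, is a strict chain
of irreducible closed sets. -/
lemma le_topologicalKrullDim_of_isOpen {d : ℕ} [Fintype ι] (hd : Fintype.card ι = d)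
    {W : Set (Aff ι)} (hW : IsOpen W) (hne : W.Nonempty) :
    (d : WithBot ℕ∞) ≤ topologicalKrullDim W := by
  classical
  obtain ⟨w, hw⟩ := hne
  let e : ι ≃ Fin d := Fintype.equivFinOfCardEq hd
  let F : ℕ → Aff ι → Aff ι := fun i x => ⟨fun j => if i ≤ (e j : ℕ) then w j else x j⟩
  have hFc : ∀ i, Continuous (F i) := fun i => RegularMapOn.continuous fun j => by
    by_cases h : i ≤ (e j : ℕ)
    · simpa [F, h] using RegularOn.const (w j)
    · simpa [F, h] using RegularOn.coord j
  have hfix : ∀ i x, (∀ j, i ≤ (e j : ℕ) → x j = w j) → F i x = x := by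
    intro i x h
    ext j
    by_cases hj : i ≤ (e j : ℕ) <;> simp [F, hj, h]
  have hFw : ∀ i, F i w = w := fun i => hfix i w fun _ _ => rfl
  let Z : ℕ → IrreducibleCloseds W := fun i =>
    { carrier := {x | ∀ j, i ≤ (e j : ℕ) → x.1 j = w j}
      isIrreducible' := by
        -- the set is the image of the open set `F i ⁻¹' W` of affine space
        have hpre : IsIrreducible (F i ⁻¹' W) := ⟨⟨w, by simp [hFw, hw]⟩,
          (IrreducibleSpace.isIrreducible_univ (Aff ι)).2.open_subset
            (hW.preimage (hFc i)) (Set.subset_univ _)⟩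
        have := Subtype.irreducibleSpace hpre
        let r : F i ⁻¹' W → W := fun y => ⟨F i y, y.2⟩
        have hr : Continuous r := ((hFc i).comp continuous_subtype_val).subtype_mk _
        convert (IrreducibleSpace.isIrreducible_univ (F i ⁻¹' W)).image r hr.continuousOn
        ext x
        constructor
        · intro h
          exact ⟨⟨x, by simp [hfix i x h]⟩, trivial, Subtype.ext (hfix i x h)⟩
        · rintro ⟨y, -, rfl⟩ j hj
          simp [r, F, hj]
      isClosed' := by
        have : {x : W | ∀ j, i ≤ (e j : ℕ) → x.1 j = w j} =
            ⋂ j, ⋂ (_ : i ≤ (e j : ℕ)), (Subtype.val ⁻¹' {x : Aff ι | x j = w j}) := by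
          ext x; simp
        rw [this]
        refine isClosed_iInter fun j => isClosed_iInter fun _ => IsClosed.preimage
          continuous_subtype_val ?_
        rw [← isOpen_compl_iff]
        convert isOpen_ev_ne_zero (MvPolynomial.X j - MvPolynomial.C (w j)) using 1
        ext x
        simp [sub_eq_zero] }
  have hZlt : ∀ i, i < d → Z i < Z (i + 1) := by
    intro i hi
    refine lt_of_le_of_ne (fun x hx j hj => hx j (by omega)) fun heq => ?_
    let j₀ := e.symm ⟨i, hi⟩
    obtain ⟨x, -, hx1, hx2⟩ := (IrreducibleSpace.isIrreducible_univ (Aff ι)).2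
      (F (i + 1) ⁻¹' W) {x | ev (.X j₀ - .C (w j₀)) x ≠ 0} (hW.preimage (hFc _))
      (isOpen_ev_ne_zero _) ⟨w, trivial, by simpa [hFw] using hw⟩
      ⟨⟨fun j => w j + 1⟩, trivial, by simp⟩
    have h1 : (⟨F (i + 1) x, hx1⟩ : W) ∈ Z (i + 1) := fun j hj => by simp [F, hj]
    rw [← heq] at h1
    have h2 : F (i + 1) x j₀ = w j₀ := h1 j₀ (by simp [j₀])
    have h3 : F (i + 1) x j₀ = x j₀ := by simp [F, j₀]
    rw [h3] at h2
    simp [h2] at hx2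
  let G : Fin (d + 1) → IrreducibleCloseds W := fun i => Z i
  have hG : StrictMono G := Fin.strictMono_iff_lt_succ.2 fun i => hZlt i i.2
  rw [topologicalKrullDim, Order.le_krullDim_iff]
  exact ⟨LTSeries.mk d G hG, rfl⟩

/-- A subset `X` of affine space has a chart at `x₀`: a relatively open neighbourhood of `x₀` in `X`
is isomorphic, by regular maps in both directions, to an open subset of `d`-dimensional affine
space. -/
def HasChartAt (X : Set (Aff σ)) (d : ℕ) (x₀ : Aff σ) : Prop :=
  ∃ (ι : Type) (_ : Fintype ι) (U : Set (Aff σ)) (W : Set (Aff ι))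
    (κ : Aff σ → Aff ι) (ψ : Aff ι → Aff σ), Fintype.card ι = d ∧ IsOpen U ∧ x₀ ∈ U ∧ IsOpen W ∧
    RegularMapOn (X ∩ U) κ ∧ RegularMapOn W ψ ∧ Set.MapsTo κ (X ∩ U) W ∧ Set.MapsTo ψ W (X ∩ U) ∧
    Set.LeftInvOn ψ κ (X ∩ U) ∧ Set.LeftInvOn κ ψ W

/-- A set is covered by `d`-dimensional affine charts. -/
def LocallyAffine (X : Set (Aff σ)) (d : ℕ) : Prop := ∀ x ∈ X, HasChartAt X d x

lemma topologicalKrullDim_chart {X U : Set (Aff σ)} {W : Set (Aff ι)} {d : ℕ} [Fintype ι]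
    {κ : Aff σ → Aff ι} {ψ : Aff ι → Aff σ} (hd : Fintype.card ι = d) (hW : IsOpen W)
    (hκ : RegularMapOn (X ∩ U) κ) (hψ : RegularMapOn W ψ) (hκW : Set.MapsTo κ (X ∩ U) W)
    (hψX : Set.MapsTo ψ W (X ∩ U)) (h1 : Set.LeftInvOn ψ κ (X ∩ U)) (h2 : Set.LeftInvOn κ ψ W)
    (hne : (X ∩ U).Nonempty) :
    topologicalKrullDim ↥(X ∩ U) = d := by
  let k : ↥(X ∩ U) → W := hκW.restrict
  let p : W → ↥(X ∩ U) := hψX.restrict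
  have hk : Continuous k := hκ.continuousOn.mapsToRestrict hκW
  have hp : Continuous p := hψ.continuousOn.mapsToRestrict hψX
  let Φ : ↥(X ∩ U) ≃ₜ W :=
    { toFun := k, invFun := p, left_inv := fun x => Subtype.ext (h1 x.2),
      right_inv := fun x => Subtype.ext (h2 x.2), continuous_toFun := hk, continuous_invFun := hp }
  rw [IsHomeomorph.topologicalKrullDim_eq Φ Φ.isHomeomorph]
  refine le_antisymm ?_ (le_topologicalKrullDim_of_isOpen hd hW ?_)
  · exact (topologicalKrullDim_subspace_le _ _).trans (hd ▸ topologicalKrullDim_aff_le)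
  · obtain ⟨x, hx⟩ := hne
    exact ⟨_, hκW hx⟩

/-- Dimension is local: a non-empty set covered by `d`-dimensional charts has dimension `d`. -/
theorem LocallyAffine.topologicalKrullDim_eq {X : Set (Aff σ)} {d : ℕ} (hX : LocallyAffine X d)
    (hne : X.Nonempty) : topologicalKrullDim X = d := by
  have key : ∀ x ∈ X, ∃ U : Set (Aff σ), IsOpen U ∧ x ∈ U ∧ topologicalKrullDim ↥(X ∩ U) = d := by
    intro x hx
    obtain ⟨ι, _, U, W, κ, ψ, hd, hU, hxU, hW, hκ, hψ, hκW, hψX, h1, h2⟩ := hX x hx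
    exact ⟨U, hU, hxU, topologicalKrullDim_chart hd hW hκ hψ hκW hψX h1 h2 ⟨x, hx, hxU⟩⟩
  have hemb : ∀ U : Set (Aff σ), IsOpen U →
      IsOpenEmbedding (Set.inclusion (Set.inter_subset_left : X ∩ U ⊆ X)) := fun U hU =>
    { toIsEmbedding := IsEmbedding.inclusion _
      isOpen_range := by
        rw [Set.range_inclusion]
        convert hU.preimage (continuous_subtype_val (p := (· ∈ X))) using 1
        ext x; simp }
  refine le_antisymm ?_ ?_
  · rw [topologicalKrullDim, Order.krullDim_eq_iSup_coheight, iSup_le_iff]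
    intro Z
    obtain ⟨x, hx⟩ := Z.isIrreducible'.nonempty
    obtain ⟨U, hU, hxU, hdim⟩ := key x.1 x.2
    let Z' := (IrreducibleCloseds.orderIsoOfIsOpenEmbedding _ (hemb U hU)).symm
      ⟨Z, ⟨⟨x.1, x.2, hxU⟩, hx⟩⟩
    have hZ' : IrreducibleCloseds.map _ (hemb U hU).continuous Z' = Z :=
      congrArg Subtype.val ((IrreducibleCloseds.orderIsoOfIsOpenEmbedding _
        (hemb U hU)).apply_symm_apply ⟨Z, ⟨⟨x.1, x.2, hxU⟩, hx⟩⟩)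
    rw [← hZ', (hemb U hU).coheight_map, ← hdim]
    exact Order.coheight_le_krullDim _
  · obtain ⟨x, hx⟩ := hne
    obtain ⟨U, hU, hxU, hdim⟩ := key x hx
    rw [← hdim]
    exact (hemb U hU).isInducing.topologicalKrullDim_le

end AffineSpace

/-! ### Fibrations with open subsets of affine space as fibres -/

section Bundles

variable {σ τ ι α ε : Type}

/-- The point of a product of affine spaces with given components. -/
def Aff.pair (x : Aff σ) (y : Aff ε) : Aff (σ ⊕ ε) := ⟨Sum.elim x y⟩

/-- The first projection of a product of affine spaces. -/
def Aff.fst (z : Aff (σ ⊕ ε)) : Aff σ := ⟨fun i => z (.inl i)⟩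

/-- The second projection of a product of affine spaces. -/
def Aff.snd (z : Aff (σ ⊕ ε)) : Aff ε := ⟨fun i => z (.inr i)⟩

@[simp] lemma Aff.fst_pair (x : Aff σ) (y : Aff ε) : (x.pair y).fst = x := rfl

@[simp] lemma Aff.snd_pair (x : Aff σ) (y : Aff ε) : (x.pair y).snd = y := rfl

@[simp] lemma Aff.pair_fst_snd (z : Aff (σ ⊕ ε)) : z.fst.pair z.snd = z := by
  ext (i | i) <;> rfl

namespace RegularMapOn

lemma pair {S : Set (Aff α)} {F : Aff α → Aff σ} {G : Aff α → Aff ε} (hF : RegularMapOn S F)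
    (hG : RegularMapOn S G) : RegularMapOn S fun x => (F x).pair (G x) := by
  rintro (i | i)
  exacts [hF i, hG i]

lemma fst {S : Set (Aff (σ ⊕ ε))} : RegularMapOn S Aff.fst := fun i => .coord (Sum.inl i)

lemma snd {S : Set (Aff (σ ⊕ ε))} : RegularMapOn S Aff.snd := fun i => .coord (Sum.inr i)

lemma const {S : Set (Aff α)} (x : Aff σ) : RegularMapOn S fun _ => x := fun i => .const (x i)

lemma id {S : Set (Aff α)} : RegularMapOn S fun x => x := fun i => .coord i

lemma comp₂ {S : Set (Aff α)} {T : Set (Aff σ)} {Θ : Aff σ → Aff ε → Aff τ} {F : Aff α → Aff σ}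
    {G : Aff α → Aff ε} (hΘ : RegularMapOn {z : Aff (σ ⊕ ε) | z.fst ∈ T} fun z => Θ z.fst z.snd)
    (hF : RegularMapOn S F) (hG : RegularMapOn S G) (hm : Set.MapsTo F S T) :
    RegularMapOn S fun x => Θ (F x) (G x) :=
  hΘ.comp (hF.pair hG) fun _ hx => hm hx

lemma isOpen_inter_preimage {S : Set (Aff σ)} {G : Aff σ → Aff τ} (h : RegularMapOn S G)
    (hS : IsOpen S) {V : Set (Aff τ)} (hV : IsOpen V) : IsOpen (S ∩ G ⁻¹' V) :=
  h.continuousOn.isOpen_inter_preimage hS hV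

/-- The preimage of an open set is open relative to the domain. -/
lemma exists_isOpen_preimage {S : Set (Aff σ)} {G : Aff σ → Aff τ} (h : RegularMapOn S G)
    {V : Set (Aff τ)} (hV : IsOpen V) :
    ∃ U, IsOpen U ∧ ∀ x ∈ S, x ∈ U ↔ G x ∈ V := by
  obtain ⟨U, hU, hUV⟩ := continuousOn_iff'.1 h.continuousOn V hV
  refine ⟨U, hU, fun x hx => ⟨fun hxU => ?_, fun hxV => ?_⟩⟩
  · have : x ∈ G ⁻¹' V ∩ S := hUV ▸ ⟨hxU, hx⟩
    exact this.1
  · have : x ∈ U ∩ S := hUV ▸ ⟨hxV, hx⟩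
    exact this.1

end RegularMapOn

/-- The map `p : Y → X` is, locally on `X`, isomorphic to the projection to `X` of an open subset of
the product of `X` with `e`-dimensional affine space. All fibres are required to be non-empty. The
openness is expressed by one open set `O` of the space around `Y`. -/
structure IsLocallyOpenInBundle (X : Set (Aff σ)) (Y : Set (Aff τ)) (p : Aff τ → Aff σ) (e : ℕ) :
    Prop where
  regular : RegularMapOn Set.univ p
  mapsTo : Set.MapsTo p Y X
  surjOn : ∀ x ∈ X, ∃ y ∈ Y, p y = x
  trivial : ∃ O : Set (Aff τ), IsOpen O ∧ Y ⊆ O ∧ ∀ x₀ ∈ X, ∃ (U : Set (Aff σ)) (ε : Type)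
    (_ : Fintype ε) (Θ : Aff σ → Aff ε → Aff τ) (π : Aff τ → Aff ε), IsOpen U ∧ x₀ ∈ U ∧
    Fintype.card ε = e ∧ RegularMapOn {z : Aff (σ ⊕ ε) | z.fst ∈ X ∩ U} (fun z => Θ z.fst z.snd) ∧
    RegularMapOn Set.univ π ∧
    (∀ x ∈ X ∩ U, ∀ v, p (Θ x v) = x ∧ π (Θ x v) = v ∧ (Θ x v ∈ O → Θ x v ∈ Y)) ∧
    ∀ y ∈ Y, p y ∈ U → Θ (p y) (π y) = y

variable {X : Set (Aff σ)} {Y : Set (Aff τ)} {p : Aff τ → Aff σ} {d e : ℕ}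

theorem LocallyAffine.of_isLocallyOpenInBundle (hX : LocallyAffine X d)
    (h : IsLocallyOpenInBundle X Y p e) : LocallyAffine Y (d + e) := by
  obtain ⟨hp, hpY, -, O, hO, hYO, htriv⟩ := h
  intro y₀ hy₀
  obtain ⟨U, ε, _, Θ, π, hU, hxU, hε, hΘ, hπ, hΘ', hπ'⟩ := htriv _ (hpY hy₀)
  obtain ⟨ι, _, U', W, κ, ψ, hd, hU', hxU', hW, hκ, hψ, hκW, hψX, h1, h2⟩ := hX _ (hpY hy₀)
  have hW₁ : IsOpen (W ∩ ψ ⁻¹' U) := hψ.isOpen_inter_preimage hW hU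
  have hfst : ∀ S : Set (Aff ι), IsOpen S → IsOpen {z : Aff (ι ⊕ ε) | z.fst ∈ S} := fun S hS =>
    hS.preimage RegularMapOn.fst.continuous
  have hreg : RegularMapOn {z : Aff (ι ⊕ ε) | z.fst ∈ W ∩ ψ ⁻¹' U}
      (fun z => Θ (ψ z.fst) z.snd) :=
    hΘ.comp₂ ((hψ.mono Set.inter_subset_left).comp RegularMapOn.fst fun _ hz => hz)
      RegularMapOn.snd fun z hz => ⟨(hψX hz.1).1, hz.2⟩
  refine ⟨ι ⊕ ε, inferInstance, p ⁻¹' (U ∩ U'),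
    {z : Aff (ι ⊕ ε) | z.fst ∈ W ∩ ψ ⁻¹' U} ∩ (fun z => Θ (ψ z.fst) z.snd) ⁻¹' O,
    fun y => (κ (p y)).pair (π y), fun z => Θ (ψ z.fst) z.snd, ?_, ?_, ⟨hxU, hxU'⟩, ?_, ?_, ?_, ?_,
    ?_, ?_, ?_⟩
  · rw [Fintype.card_sum, hd, hε]
  · exact (hU.inter hU').preimage hp.continuous
  · exact hreg.isOpen_inter_preimage (hfst _ hW₁) hO
  · exact (hκ.comp (hp.mono (Set.subset_univ _)) fun y hy => ⟨hpY hy.1, hy.2.2⟩).pair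
      (hπ.mono (Set.subset_univ _))
  · exact hreg.mono Set.inter_subset_left
  · rintro y ⟨hy, hyU, hyU'⟩
    have hk : ψ (κ (p y)) = p y := h1 ⟨hpY hy, hyU'⟩
    refine ⟨⟨hκW ⟨hpY hy, hyU'⟩, ?_⟩, ?_⟩
    · change ψ (κ (p y)) ∈ U
      rwa [hk]
    · change Θ (ψ (κ (p y))) (π y) ∈ O
      rw [hk, hπ' y hy hyU]
      exact hYO hy
  · rintro z ⟨⟨hzW, hzU⟩, hzO⟩
    obtain ⟨ha, hb, hc⟩ := hΘ' (ψ z.fst) ⟨(hψX hzW).1, hzU⟩ z.snd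
    refine ⟨hc hzO, ?_⟩
    rw [Set.mem_preimage, ha]
    exact ⟨hzU, (hψX hzW).2⟩
  · rintro y ⟨hy, hyU, hyU'⟩
    have hk : ψ (κ (p y)) = p y := h1 ⟨hpY hy, hyU'⟩
    simp only [Aff.fst_pair, Aff.snd_pair, hk, hπ' y hy hyU]
  · rintro z ⟨⟨hzW, hzU⟩, hzO⟩
    obtain ⟨ha, hb, hc⟩ := hΘ' (ψ z.fst) ⟨(hψX hzW).1, hzU⟩ z.snd
    simp only [ha, hb, h2 hzW, Aff.pair_fst_snd]

/-- Two non-empty open subsets of `Y` have a point in a common fibre, because sections of the bundle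
show that `p` is open; they meet in this fibre, which is irreducible. -/
theorem isIrreducible_of_isLocallyOpenInBundle (hX : IsIrreducible X)
    (h : IsLocallyOpenInBundle X Y p e) : IsIrreducible Y := by
  obtain ⟨hp, hpY, hsurj, O, hO, hYO, htriv⟩ := h
  refine ⟨?_, ?_⟩
  · obtain ⟨x, hx⟩ := hX.1
    obtain ⟨y, hy, -⟩ := hsurj x hx
    exact ⟨y, hy⟩
  have key : ∀ V : Set (Aff τ), IsOpen V → (Y ∩ V).Nonempty → ∃ G : Set (Aff σ), IsOpen G ∧
      (X ∩ G).Nonempty ∧ ∀ x ∈ X ∩ G, ∃ y ∈ Y ∩ V, p y = x := by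
    rintro V hV ⟨y₁, hy₁, hyV⟩
    obtain ⟨U, ε, _, Θ, π, hU, hxU, hε, hΘ, hπ, hΘ', hπ'⟩ := htriv _ (hpY hy₁)
    have hs : RegularMapOn (X ∩ U) fun x => Θ x (π y₁) :=
      hΘ.comp₂ RegularMapOn.id (RegularMapOn.const _) fun x hx => hx
    obtain ⟨G, hG, hGV⟩ := hs.exists_isOpen_preimage (hV.inter hO)
    refine ⟨G ∩ U, hG.inter hU, ⟨p y₁, hpY hy₁, ?_, hxU⟩, ?_⟩
    · rw [hGV _ ⟨hpY hy₁, hxU⟩, hπ' _ hy₁ hxU]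
      exact ⟨hyV, hYO hy₁⟩
    · rintro x ⟨hx, hxG, hxU⟩
      obtain ⟨ha, hb⟩ := (hGV x ⟨hx, hxU⟩).1 hxG
      obtain ⟨hc, -, hd⟩ := hΘ' x ⟨hx, hxU⟩ (π y₁)
      exact ⟨_, ⟨hd hb, ha⟩, hc⟩
  intro V₁ V₂ hV₁ hV₂ hne₁ hne₂
  obtain ⟨G₁, hG₁, hX₁, hl₁⟩ := key V₁ hV₁ hne₁
  obtain ⟨G₂, hG₂, hX₂, hl₂⟩ := key V₂ hV₂ hne₂
  obtain ⟨x, hx, hxG₁, hxG₂⟩ := hX.2 G₁ G₂ hG₁ hG₂ hX₁ hX₂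
  obtain ⟨y₁, ⟨hy₁, hyV₁⟩, hpy₁⟩ := hl₁ x ⟨hx, hxG₁⟩
  obtain ⟨y₂, ⟨hy₂, hyV₂⟩, hpy₂⟩ := hl₂ x ⟨hx, hxG₂⟩
  obtain ⟨U, ε, _, Θ, π, hU, hxU, hε, hΘ, hπ, hΘ', hπ'⟩ := htriv x hx
  have hf : Continuous fun v => Θ x v := RegularMapOn.continuous
    (hΘ.comp₂ (RegularMapOn.const x) RegularMapOn.id fun _ _ => ⟨hx, hxU⟩)
  have h1 : Θ x (π y₁) = y₁ := by simpa [hpy₁] using hπ' y₁ hy₁ (by rwa [hpy₁])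
  have h2 : Θ x (π y₂) = y₂ := by simpa [hpy₂] using hπ' y₂ hy₂ (by rwa [hpy₂])
  obtain ⟨v, -, ⟨hv₁, hvO⟩, hv₂⟩ := (IrreducibleSpace.isIrreducible_univ (Aff ε)).2 _ _
    ((hV₁.inter hO).preimage hf) (hV₂.preimage hf)
    ⟨π y₁, Set.mem_univ _, by rw [Set.mem_preimage, h1]; exact ⟨hyV₁, hYO hy₁⟩⟩
    ⟨π y₂, Set.mem_univ _, by rwa [Set.mem_preimage, h2]⟩
  exact ⟨_, (hΘ' x ⟨hx, hxU⟩ v).2.2 hvO, hv₁, hv₂⟩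

end Bundles

/-! ### Regular families of matrices -/

section Families

variable {σ a b c n : Type}

/-- A family of matrices is regular on `S` if its entries are. -/
def RegularMatOn (S : Set (Aff σ)) (M : Aff σ → Matrix a b ℂ) : Prop :=
  ∀ i j, RegularOn S fun x => M x i j

namespace RegularMatOn

variable {S T : Set (Aff σ)}

lemma mono {M : Aff σ → Matrix a b ℂ} (h : RegularMatOn T M) (hST : S ⊆ T) : RegularMatOn S M :=
  fun i j => (h i j).mono hST

lemma const (M : Matrix a b ℂ) : RegularMatOn S fun _ => M := fun i j => .const (M i j)

lemma mul [Fintype b] {M : Aff σ → Matrix a b ℂ} {N : Aff σ → Matrix b c ℂ}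
    (hM : RegularMatOn S M) (hN : RegularMatOn S N) : RegularMatOn S fun x => M x * N x :=
  fun i j => .sum _ fun k _ => (hM i k).mul (hN k j)

lemma one [DecidableEq n] : RegularMatOn S fun _ : Aff σ => (1 : Matrix n n ℂ) := const 1

lemma pow [Fintype n] [DecidableEq n] {M : Aff σ → Matrix n n ℂ} (hM : RegularMatOn S M) (r : ℕ) :
    RegularMatOn S fun x => M x ^ r := by
  induction r with
  | zero => simpa using one
  | succ r ih => simpa only [pow_succ] using ih.mul hM

lemma submatrix {M : Aff σ → Matrix a b ℂ} (hM : RegularMatOn S M) {a' b' : Type} (f : a' → a)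
    (g : b' → b) : RegularMatOn S fun x => (M x).submatrix f g :=
  fun i j => hM (f i) (g j)

lemma det [Fintype n] [DecidableEq n] {M : Aff σ → Matrix n n ℂ} (hM : RegularMatOn S M) :
    RegularOn S fun x => (M x).det := by
  simp only [Matrix.det_apply, Units.smul_def, zsmul_eq_mul]
  exact .sum _ fun p _ => (RegularOn.const _).mul (.prod _ fun i _ => hM _ _)

lemma inv [Fintype n] [DecidableEq n] {M : Aff σ → Matrix n n ℂ} (hM : RegularMatOn S M)
    (h0 : ∀ x ∈ S, (M x).det ≠ 0) : RegularMatOn S fun x => (M x)⁻¹ := by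
  intro i j
  have hadj : RegularOn S fun x => (M x).adjugate i j := by
    simp only [Matrix.adjugate_apply]
    refine RegularMatOn.det fun k l => ?_
    by_cases hk : k = j
    · subst hk
      simpa using RegularOn.const _
    · simpa [Matrix.updateRow_ne hk] using hM k l
  refine ((hM.det.inv h0).mul hadj).congr fun x _ => ?_
  change (M x)⁻¹ i j = _
  rw [Matrix.inv_def, Ring.inverse_eq_inv']
  rfl

end RegularMatOn

/-- The kernels of a regular family of matrices form a vector bundle if their dimension is constant:
locally there is a regular family `K` of bases of the kernels, normalized by `Q * K x = 1` for a
fixed matrix `Q`.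

At the base point `M` is completed by `Q` to an injective map, after a projection `P` of its target;
the same matrices `P` and `Q` serve for neighbouring points. -/
theorem exists_regular_kernel_basis [Fintype b] [DecidableEq b] [Fintype c] [DecidableEq c]
    {X : Set (Aff σ)} {M : Aff σ → Matrix c b ℂ} (hM : RegularMatOn X M) {e : ℕ}
    (he : ∀ x ∈ X, Module.finrank ℂ (LinearMap.ker (M x).mulVecLin) = e) {x₀ : Aff σ}
    (hx₀ : x₀ ∈ X) :
    ∃ (U : Set (Aff σ)) (K : Aff σ → Matrix b (Fin e) ℂ) (Q : Matrix (Fin e) b ℂ),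
      IsOpen U ∧ x₀ ∈ U ∧ RegularMatOn (X ∩ U) K ∧ ∀ x ∈ X ∩ U, M x * K x = 0 ∧ Q * K x = 1 ∧
        ∀ v, M x *ᵥ v = 0 → K x *ᵥ (Q *ᵥ v) = v := by
  set L := (M x₀).mulVecLin with hL
  have hrank := L.finrank_range_add_finrank_ker
  rw [he x₀ hx₀, Module.finrank_fintype_fun_eq_card] at hrank
  set k := Module.finrank ℂ (LinearMap.range L) with hk
  obtain ⟨p, hp⟩ := LinearMap.exists_extend
    (LinearEquiv.ofFinrankEq (LinearMap.range L) (Fin k → ℂ) (by simp [hk])).toLinearMap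
  obtain ⟨q, hq⟩ := LinearMap.exists_extend
    (LinearEquiv.ofFinrankEq (LinearMap.ker L) (Fin e → ℂ) (by
      rw [hL, he x₀ hx₀, Module.finrank_fintype_fun_eq_card, Fintype.card_fin])).toLinearMap
  let P := LinearMap.toMatrix' p
  let Q := LinearMap.toMatrix' q
  let f : b ≃ Fin k ⊕ Fin e := Fintype.equivOfCardEq (by simp [hrank])
  let B : Aff σ → Matrix b b ℂ := fun x => Matrix.of fun i j =>
    Sum.elim (fun l => (P * M x) l j) (fun l => Q l j) (f i)
  have hBl : ∀ x v l, (B x *ᵥ v) (f.symm (.inl l)) = (P *ᵥ (M x *ᵥ v)) l := fun x v l => by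
    rw [Matrix.mulVec_mulVec]; simp [B, Matrix.mulVec, dotProduct]
  have hBr : ∀ x v l, (B x *ᵥ v) (f.symm (.inr l)) = (Q *ᵥ v) l := fun x v l => by
    simp [B, Matrix.mulVec, dotProduct]
  have hB : RegularMatOn X B := by
    intro i j
    have hPM : RegularMatOn X fun x => P * M x := (RegularMatOn.const P).mul hM
    rcases hi : f i with l | l
    · simpa [B, hi] using hPM l j
    · simpa [B, hi] using RegularOn.const _
  have hdet : (B x₀).det ≠ 0 := by
    intro h0
    obtain ⟨v, hv, hBv⟩ := Matrix.exists_mulVec_eq_zero_iff.2 h0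
    have h1 : L v = 0 := by
      have : p (L v) = 0 := by
        ext l
        have := hBl x₀ v l
        rw [hBv] at this
        simpa [P, hL, LinearMap.toMatrix'_mulVec, -Matrix.mulVec_mulVec] using this.symm
      have h2 := LinearMap.congr_fun hp ⟨L v, LinearMap.mem_range_self L v⟩
      simp only [LinearMap.comp_apply, Submodule.subtype_apply, this] at h2
      simpa using (LinearEquiv.map_eq_zero_iff _).1 h2.symm
    have h2 : q v = 0 := by
      ext l
      have := hBr x₀ v l
      rw [hBv] at this
      simpa [Q, LinearMap.toMatrix'_mulVec] using this.symm
    have h3 := LinearMap.congr_fun hq ⟨v, h1⟩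
    simp only [LinearMap.comp_apply, Submodule.subtype_apply, h2] at h3
    have h4 := (LinearEquiv.map_eq_zero_iff _).1 h3.symm
    exact hv (congrArg Subtype.val h4)
  obtain ⟨d, hd⟩ := hB.det.exists_poly_ne_zero
  let K : Aff σ → Matrix b (Fin e) ℂ := fun x => (B x)⁻¹.submatrix id fun l => f.symm (.inr l)
  have hU : ∀ x ∈ X ∩ {x | ev d x ≠ 0}, (B x).det ≠ 0 := fun x hx => (hd x hx.1).2 hx.2
  refine ⟨{x | ev d x ≠ 0}, K, Q, isOpen_ev_ne_zero d, (hd x₀ hx₀).1 hdet,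
    ((hB.mono Set.inter_subset_left).inv hU).submatrix _ _, fun x hx => ?_⟩
  have hinv : (B x)⁻¹ * B x = 1 := Matrix.nonsing_inv_mul _ (isUnit_iff_ne_zero.2 (hU x hx))
  have hinv' : B x * (B x)⁻¹ = 1 := Matrix.mul_nonsing_inv _ (isUnit_iff_ne_zero.2 (hU x hx))
  have hKv : ∀ y, K x *ᵥ y = (B x)⁻¹ *ᵥ fun i => Sum.elim (fun _ => 0) y (f i) := by
    intro y
    ext i
    simp only [Matrix.mulVec, dotProduct, K, Matrix.submatrix_apply, id]
    rw [← f.symm.sum_comp, Fintype.sum_sum_type]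
    simp
  have hQK : Q * K x = 1 := by
    ext l l'
    have h1 := congrFun (congrFun hinv' (f.symm (.inr l))) (f.symm (.inr l'))
    rw [Matrix.one_apply] at h1 ⊢
    simp only [EmbeddingLike.apply_eq_iff_eq, Sum.inr.injEq] at h1
    rw [← h1, Matrix.mul_apply, Matrix.mul_apply]
    exact Finset.sum_congr rfl fun i _ => by simp [B, K]
  have hKQ : ∀ v, M x *ᵥ v = 0 → K x *ᵥ (Q *ᵥ v) = v := by
    intro v hv
    rw [hKv]
    have : (fun i => Sum.elim (fun _ => 0) (Q *ᵥ v) (f i)) = B x *ᵥ v := by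
      ext i
      obtain ⟨s, rfl⟩ := f.symm.surjective i
      rcases s with l | l
      · rw [hBl, hv]; simp
      · rw [hBr]; simp
    rw [this, Matrix.mulVec_mulVec, hinv, Matrix.one_mulVec]
  refine ⟨?_, hQK, hKQ⟩
  -- `Q` is injective on the kernel of `M x`, hence bijective, for reasons of dimension
  have hinj : Function.Injective (Q.mulVecLin.domRestrict (LinearMap.ker (M x).mulVecLin)) := by
    rintro ⟨v, hv⟩ ⟨w, hw⟩ hvw
    have h1 : Q *ᵥ v = Q *ᵥ w := hvw
    have hv' := hKQ v hv
    rw [h1, hKQ w hw] at hv'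
    exact Subtype.ext hv'.symm
  have hsurj := (LinearMap.injective_iff_surjective_of_finrank_eq_finrank
    (by simp [he x hx.1])).1 hinj
  refine Matrix.ext_iff_mulVec.2 fun y => ?_
  obtain ⟨⟨v, hv⟩, rfl⟩ := hsurj y
  have h1 : K x *ᵥ (Q *ᵥ v) = v := hKQ v hv
  rw [← Matrix.mulVec_mulVec, Matrix.zero_mulVec]
  change M x *ᵥ (K x *ᵥ (Q *ᵥ v)) = 0
  rw [h1]
  exact hv

/-- The matrix of the linear map `G ↦ A * G - G * J`. -/
def intertwiner [DecidableEq n] (J A : Matrix n n ℂ) : Matrix (n × n) (n × n) ℂ :=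
  Matrix.of fun p q => (if q.2 = p.2 then A p.1 q.1 else 0) - if p.1 = q.1 then J q.2 p.2 else 0

lemma intertwiner_mulVec [Fintype n] [DecidableEq n] (J A G : Matrix n n ℂ) (p : n × n) :
    (intertwiner J A *ᵥ fun q => G q.1 q.2) p = (A * G - G * J) p.1 p.2 := by
  simp only [intertwiner, Matrix.mulVec, dotProduct, Matrix.of_apply, sub_mul,
    Finset.sum_sub_distrib, Matrix.sub_apply, Matrix.mul_apply, Fintype.sum_prod_type, ite_mul,
    zero_mul]
  congr 1
  · simp
  · rw [Finset.sum_comm]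
    simp [mul_comm]

lemma intertwiner_mulVec_eq_zero_iff [Fintype n] [DecidableEq n] (J A : Matrix n n ℂ)
    (v : n × n → ℂ) : intertwiner J A *ᵥ v = 0 ↔
      A * Matrix.of (fun i j => v (i, j)) = Matrix.of (fun i j => v (i, j)) * J := by
  rw [← sub_eq_zero (b := _ * J), ← Matrix.ext_iff, funext_iff, Prod.forall]
  refine forall₂_congr fun i j => ?_
  rw [← intertwiner_mulVec J A (Matrix.of fun i j => v (i, j)) (i, j)]
  rfl

/-- The orbit map of a conjugacy class has local sections: matrices of a regular family that are all
conjugate to `J` are so by a matrix that can be chosen regular locally. The matrices `G` with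
`A * G = G * J` form a vector space of dimension independent of `A`. -/
theorem exists_regular_conjugation [Fintype n] [DecidableEq n] {X : Set (Aff σ)}
    {A : Aff σ → Matrix n n ℂ} (hA : RegularMatOn X A) {J : Matrix n n ℂ}
    (hJ : ∀ x ∈ X, ∃ g : (Matrix n n ℂ)ˣ, A x * g = g * J) {x₀ : Aff σ} (hx₀ : x₀ ∈ X) :
    ∃ (U : Set (Aff σ)) (g h : Aff σ → Matrix n n ℂ), IsOpen U ∧ x₀ ∈ U ∧
      RegularMatOn (X ∩ U) g ∧ RegularMatOn (X ∩ U) h ∧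
      ∀ x ∈ X ∩ U, g x * h x = 1 ∧ h x * g x = 1 ∧ A x * g x = g x * J := by
  have hM : RegularMatOn X fun x => intertwiner J (A x) := by
    intro p q
    simp only [intertwiner, Matrix.of_apply]
    refine RegularOn.sub ?_ (RegularOn.const _)
    split_ifs
    exacts [hA _ _, RegularOn.const _]
  have he : ∀ x ∈ X, Module.finrank ℂ (LinearMap.ker (intertwiner J (A x)).mulVecLin) =
      Module.finrank ℂ (LinearMap.ker (intertwiner J J).mulVecLin) := by
    intro x hx
    obtain ⟨g, hg⟩ := hJ x hx
    let mulLeft : Matrix n n ℂ → ((n × n → ℂ) →ₗ[ℂ] (n × n → ℂ)) := fun u =>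
      { toFun := fun v p => (u * Matrix.of fun i j => v (i, j)) p.1 p.2
        map_add' := fun v w => by
          ext p; simp [Matrix.mul_apply, mul_add, Finset.sum_add_distrib]
        map_smul' := fun t v => by
          ext p; simp [Matrix.mul_apply, Finset.mul_sum, mul_left_comm] }
    have hmul : ∀ u w v, mulLeft u (mulLeft w v) = mulLeft (u * w) v := fun u w v => by
      ext p
      simp only [mulLeft, LinearMap.coe_mk, AddHom.coe_mk, Matrix.mul_assoc]
      rfl
    have hone : ∀ v, mulLeft 1 v = v := fun v => by
      ext p; simp [mulLeft]
    let Φ : (n × n → ℂ) ≃ₗ[ℂ] (n × n → ℂ) := LinearEquiv.ofLinearMap (mulLeft g) (mulLeft ↑g⁻¹)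
      (LinearMap.ext fun v => by simp [hmul, hone]) (LinearMap.ext fun v => by simp [hmul, hone])
    have hker : LinearMap.ker (intertwiner J (A x)).mulVecLin =
        (LinearMap.ker (intertwiner J J).mulVecLin).map Φ.toLinearMap := by
      rw [← LinearEquiv.symm_symm Φ, ← Submodule.comap_equiv_eq_map_symm Φ.symm]
      ext v
      simp only [LinearMap.mem_ker, Matrix.mulVecLin_apply, Submodule.mem_comap,
        intertwiner_mulVec_eq_zero_iff]
      set G : Matrix n n ℂ := Matrix.of fun i j => v (i, j)
      have h1 : (Matrix.of fun i j => (Φ.symm.toLinearMap v) (i, j) : Matrix n n ℂ) =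
          (g⁻¹ : (Matrix n n ℂ)ˣ) * G := rfl
      have h2 : ((g⁻¹ : (Matrix n n ℂ)ˣ) : Matrix n n ℂ) * A x = J * (g⁻¹ : (Matrix n n ℂ)ˣ) := by
        rw [Units.inv_mul_eq_iff_eq_mul, ← mul_assoc, Units.eq_mul_inv_iff_mul_eq, hg]
      rw [h1]
      rw [← mul_assoc J, ← h2, mul_assoc, mul_assoc, Units.mul_right_inj]
    rw [hker, LinearEquiv.finrank_map_eq]
  obtain ⟨U, K, Q, hU, hxU, hK, hKQ⟩ := exists_regular_kernel_basis hM he hx₀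
  obtain ⟨g₀, hg₀⟩ := hJ x₀ hx₀
  let v₀ : n × n → ℂ := fun p => (g₀ : Matrix n n ℂ) p.1 p.2
  let g : Aff σ → Matrix n n ℂ := fun x => Matrix.of fun i j => (K x *ᵥ (Q *ᵥ v₀)) (i, j)
  have hg : RegularMatOn (X ∩ U) g := fun i j => by
    change RegularOn _ fun x => ∑ k, K x (i, j) k * (Q *ᵥ v₀) k
    exact .sum _ fun k _ => (hK _ k).mul (.const _)
  have hgJ : ∀ x ∈ X ∩ U, A x * g x = g x * J := by
    intro x hx
    refine (intertwiner_mulVec_eq_zero_iff J (A x) _).1 ?_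
    rw [Matrix.mulVec_mulVec, (hKQ x hx).1, Matrix.zero_mulVec]
  have hgx₀ : g x₀ = g₀ := by
    have : K x₀ *ᵥ (Q *ᵥ v₀) = v₀ :=
      (hKQ x₀ ⟨hx₀, hxU⟩).2.2 v₀ ((intertwiner_mulVec_eq_zero_iff J (A x₀) v₀).2 hg₀)
    ext i j
    simp only [g, this, Matrix.of_apply, v₀]
  obtain ⟨d, hd⟩ := hg.det.exists_poly_ne_zero
  have hdet : ∀ x ∈ X ∩ (U ∩ {x | ev d x ≠ 0}), (g x).det ≠ 0 := fun x hx =>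
    (hd x ⟨hx.1, hx.2.1⟩).2 hx.2.2
  have hmono : X ∩ (U ∩ {x | ev d x ≠ 0}) ⊆ X ∩ U := fun x hx => ⟨hx.1, hx.2.1⟩
  refine ⟨U ∩ {x | ev d x ≠ 0}, g, fun x => (g x)⁻¹, hU.inter (isOpen_ev_ne_zero d), ⟨hxU, ?_⟩,
    hg.mono hmono, (hg.mono hmono).inv hdet, fun x hx => ⟨?_, ?_, hgJ x (hmono hx)⟩⟩
  · refine (hd x₀ ⟨hx₀, hxU⟩).1 ?_
    rw [hgx₀]
    exact ((Matrix.isUnit_iff_isUnit_det _).1 g₀.isUnit).ne_zero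
  · exact Matrix.mul_nonsing_inv _ (isUnit_iff_ne_zero.2 (hdet x hx))
  · exact Matrix.nonsing_inv_mul _ (isUnit_iff_ne_zero.2 (hdet x hx))

end Families

/-! ### Ranks of powers in a cyclic extension -/

section Extension

variable {V V' : Type*} [AddCommGroup V] [Module ℂ V]
  [AddCommGroup V'] [Module ℂ V']

open Module

/-- The smallest `T`-stable subspace containing `x`. -/
def cyclicSpan (T : End ℂ V) (x : V) : Submodule ℂ V :=
  Submodule.span ℂ (Set.range fun i : ℕ => (T ^ i) x)

lemma pow_mem_cyclicSpan (T : End ℂ V) (x : V) (i : ℕ) : (T ^ i) x ∈ cyclicSpan T x :=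
  Submodule.subset_span ⟨i, rfl⟩

lemma map_pow_cyclicSpan (T : End ℂ V) (x : V) (r : ℕ) :
    (cyclicSpan T x).map (T ^ r) = cyclicSpan T ((T ^ r) x) := by
  rw [cyclicSpan, Submodule.map_span, cyclicSpan, ← Set.range_comp]
  congr! 2
  ext i
  simp only [Function.comp, ← Module.End.mul_apply, ← pow_add, add_comm]

lemma pow_apply_mem {T : End ℂ V} {N : Submodule ℂ V} (hN : ∀ x ∈ N, T x ∈ N) {x : V} (hx : x ∈ N)
    (i : ℕ) : (T ^ i) x ∈ N := by
  induction i with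
  | zero => simpa
  | succ i ih => rw [pow_succ', Module.End.mul_apply]; exact hN _ ih

lemma cyclicSpan_le {T : End ℂ V} {N : Submodule ℂ V} (hN : ∀ x ∈ N, T x ∈ N) {x : V} (hx : x ∈ N) :
    cyclicSpan T x ≤ N := by
  rw [cyclicSpan, Submodule.span_le]
  rintro _ ⟨i, rfl⟩
  exact pow_apply_mem hN hx i

/-- A form of the Nakayama lemma for the nilpotent endomorphism `T`: modulo `N`, a vector that is
a combination of its images under the positive powers of `T` is zero. -/
lemma mem_of_mem_sup_cyclicSpan {T : End ℂ V} (hT : IsNilpotent T) {N : Submodule ℂ V}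
    (hN : ∀ x ∈ N, T x ∈ N) {x : V} (hx : x ∈ N ⊔ cyclicSpan T (T x)) : x ∈ N := by
  have key : ∀ k, (T ^ (k + 1)) x ∈ N → (T ^ k) x ∈ N := by
    intro k hk
    have h1 : (T ^ k) x ∈ (N ⊔ cyclicSpan T (T x)).map (T ^ k) := Submodule.mem_map_of_mem hx
    rw [Submodule.map_sup, map_pow_cyclicSpan, ← Module.End.mul_apply, ← pow_succ] at h1
    refine (sup_le ?_ (cyclicSpan_le hN hk)) h1
    rintro _ ⟨y, hy, rfl⟩
    exact pow_apply_mem hN hy k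
  obtain ⟨K, hK⟩ := hT
  have h0 : (T ^ K) x ∈ N := by simp [hK]
  clear hK hx
  induction K with
  | zero => simpa using h0
  | succ K ih => exact ih (key K h0)

/-- Modulo an invariant subspace `N`, the vectors `x, T x, …, T ^ l x` are independent as soon as
the last one is non-zero, because `T` is nilpotent. -/
lemma finrank_add_le_finrank_sup_cyclicSpan [FiniteDimensional ℂ V] {T : End ℂ V}
    (hT : IsNilpotent T) {N : Submodule ℂ V} (hN : ∀ x ∈ N, T x ∈ N) {l : ℕ} {x : V}
    (hx : (T ^ l) x ∉ N) :
    finrank ℂ N + l + 1 ≤ finrank ℂ ↥(N ⊔ cyclicSpan T x) := by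
  induction l generalizing x with
  | zero =>
    refine Submodule.finrank_lt_finrank_of_lt (lt_of_le_of_ne le_sup_left fun h => hx ?_)
    rw [h]
    exact (le_sup_right : cyclicSpan T x ≤ _) (pow_mem_cyclicSpan T x 0)
  | succ l ih =>
    have h1 := ih (x := T x) (by rwa [pow_succ, Module.End.mul_apply] at hx)
    have hxN : x ∉ N := fun h => hx (pow_apply_mem hN h _)
    have hlt : N ⊔ cyclicSpan T (T x) < N ⊔ cyclicSpan T x := by
      refine lt_of_le_of_ne (sup_le_sup_left ?_ _) fun h => hxN ?_
      · rw [cyclicSpan, Submodule.span_le]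
        rintro _ ⟨i, rfl⟩
        have := pow_mem_cyclicSpan T x (i + 1)
        rwa [pow_succ, Module.End.mul_apply] at this
      · refine mem_of_mem_sup_cyclicSpan hT hN ?_
        rw [h]
        exact (le_sup_right : cyclicSpan T x ≤ _) (pow_mem_cyclicSpan T x 0)
    have := Submodule.finrank_lt_finrank_of_lt hlt
    omega

lemma range_pow_eq_sup {T : End ℂ V} {W : Submodule ℂ V} {x : V} (hW : W ⊔ cyclicSpan T x = ⊤)
    (r : ℕ) : LinearMap.range (T ^ r) = W.map (T ^ r) ⊔ cyclicSpan T ((T ^ r) x) := by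
  rw [← map_pow_cyclicSpan, ← Submodule.map_sup, hW, LinearMap.range_eq_map]

lemma map_pow_invariant {T : End ℂ V} {W : Submodule ℂ V} (hTW : ∀ x ∈ W, T x ∈ W) (r : ℕ) :
    ∀ x ∈ W.map (T ^ r), T x ∈ W.map (T ^ r) := by
  rintro _ ⟨y, hy, rfl⟩
  refine ⟨T y, hTW y hy, ?_⟩
  rw [← Module.End.mul_apply, ← Module.End.mul_apply, ← pow_succ, ← pow_succ']

lemma finrank_range_pow_le_of_mem [FiniteDimensional ℂ V] {T : End ℂ V} {W : Submodule ℂ V}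
    (hTW : ∀ x ∈ W, T x ∈ W) {x : V} (hW : W ⊔ cyclicSpan T x = ⊤) {r n : ℕ} (hn : r ≤ n)
    (hx : (T ^ n) x ∈ W.map (T ^ r)) :
    finrank ℂ (LinearMap.range (T ^ r)) ≤ finrank ℂ ↥(W.map (T ^ r)) + (n - r) := by
  let S := Submodule.span ℂ (Set.range fun i : Fin (n - r) => (T ^ (r + i)) x)
  have h1 : LinearMap.range (T ^ r) ≤ W.map (T ^ r) ⊔ S := by
    rw [range_pow_eq_sup hW]
    refine sup_le le_sup_left ?_
    rw [cyclicSpan, Submodule.span_le]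
    rintro _ ⟨i, rfl⟩
    simp only [← Module.End.mul_apply, ← pow_add]
    by_cases hi : i < n - r
    · refine (le_sup_right : S ≤ _) (Submodule.subset_span ⟨⟨i, hi⟩, ?_⟩)
      simp [add_comm]
    · refine (le_sup_left : W.map (T ^ r) ≤ _) ?_
      have := pow_apply_mem (map_pow_invariant hTW r) hx (i + r - n)
      rwa [← Module.End.mul_apply, ← pow_add, Nat.sub_add_cancel (by omega)] at this
  refine (Submodule.finrank_mono h1).trans
    ((Submodule.finrank_add_le_finrank_add_finrank _ _).trans ?_)
  gcongr
  exact (finrank_range_le_card _).trans (by simp)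

lemma finrank_range_pow_ge_of_notMem [FiniteDimensional ℂ V] {T : End ℂ V} (hT : IsNilpotent T)
    {W : Submodule ℂ V} (hTW : ∀ x ∈ W, T x ∈ W) {x : V} (hW : W ⊔ cyclicSpan T x = ⊤)
    {r n : ℕ} (hn : r ≤ n) (hx : (T ^ n) x ∉ W.map (T ^ r)) :
    finrank ℂ ↥(W.map (T ^ r)) + (n - r) + 1 ≤ finrank ℂ (LinearMap.range (T ^ r)) := by
  rw [range_pow_eq_sup hW]
  refine finrank_add_le_finrank_sup_cyclicSpan hT (map_pow_invariant hTW r) ?_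
  rwa [← Module.End.mul_apply, ← pow_add, Nat.sub_add_cancel hn]

end Extension

/-- An extension of the nilpotent endomorphism `T'` of `V'` by a cyclic one: `V` is spanned by the
image of `V'` and the vectors `T ^ i x`, and `T ^ k x` is the first of these vectors which lies
in the image of `V'`, where it comes from `w`. -/
structure IsCyclicExtension {V V' : Type*} [AddCommGroup V] [Module ℂ V] [AddCommGroup V']
    [Module ℂ V'] (ι : V' →ₗ[ℂ] V) (T' : Module.End ℂ V') (T : Module.End ℂ V) (x : V) (k : ℕ)
    (w : V') : Prop where
  injective : Function.Injective ι
  comm : T ∘ₗ ι = ι ∘ₗ T'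
  nilpotent : IsNilpotent T'
  span : LinearMap.range ι ⊔ cyclicSpan T x = ⊤
  pow_eq : (T ^ k) x = ι w
  pow_notMem : ∀ i < k, (T ^ i) x ∉ LinearMap.range ι

namespace IsCyclicExtension

variable {V V' : Type*} [AddCommGroup V] [Module ℂ V]
  [AddCommGroup V'] [Module ℂ V'] {ι : V' →ₗ[ℂ] V} {T' : Module.End ℂ V'} {T : Module.End ℂ V}
  {x : V} {k : ℕ} {w : V'}

open Module

lemma pow_comm (h : IsCyclicExtension ι T' T x k w) (r : ℕ) (v : V') :
    (T ^ r) (ι v) = ι ((T' ^ r) v) := by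
  induction r generalizing v with
  | zero => rfl
  | succ r ih =>
    rw [pow_succ, pow_succ, Module.End.mul_apply, Module.End.mul_apply, ← ih]
    exact congrArg _ (LinearMap.congr_fun h.comm v)

lemma map_range (h : IsCyclicExtension ι T' T x k w) (r : ℕ) :
    (LinearMap.range ι).map (T ^ r) = (LinearMap.range (T' ^ r)).map ι := by
  ext y
  simp only [Submodule.mem_map, LinearMap.mem_range, exists_exists_eq_and, h.pow_comm]

lemma finrank_map_range (h : IsCyclicExtension ι T' T x k w) (r : ℕ) :
    finrank ℂ ↥((LinearMap.range ι).map (T ^ r)) = finrank ℂ (LinearMap.range (T' ^ r)) := by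
  rw [h.map_range]
  exact (Submodule.equivMapOfInjective ι h.injective _).finrank_eq.symm

lemma invariant (h : IsCyclicExtension ι T' T x k w) :
    ∀ y ∈ LinearMap.range ι, T y ∈ LinearMap.range ι := by
  rintro _ ⟨v, rfl⟩
  exact ⟨T' v, (LinearMap.congr_fun h.comm v).symm⟩

lemma pow_mem_iff (h : IsCyclicExtension ι T' T x k w) (r s : ℕ) :
    (T ^ (k + s)) x ∈ (LinearMap.range ι).map (T ^ r) ↔
      (T' ^ s) w ∈ LinearMap.range (T' ^ r) := by
  rw [h.map_range, add_comm, pow_add, Module.End.mul_apply, h.pow_eq, h.pow_comm]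
  exact h.injective.mem_set_image

lemma isNilpotent (h : IsCyclicExtension ι T' T x k w) : IsNilpotent T := by
  obtain ⟨K, hK⟩ := h.nilpotent
  have h0 : ∀ i v, (T ^ (K + i)) (ι v) = 0 := fun i v => by
    rw [h.pow_comm, add_comm, pow_add, Module.End.mul_apply, hK, LinearMap.zero_apply, map_zero,
      map_zero]
  refine ⟨K + k, LinearMap.ker_eq_top.1 (top_le_iff.1 ?_)⟩
  rw [← h.span]
  refine sup_le ?_ ?_
  · rintro _ ⟨v, rfl⟩
    exact h0 k v
  · rw [cyclicSpan, Submodule.span_le]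
    rintro _ ⟨i, rfl⟩
    change (T ^ (K + k)) ((T ^ i) x) = 0
    rw [← Module.End.mul_apply, ← pow_add, show K + k + i = K + i + k by ring, pow_add,
      Module.End.mul_apply, h.pow_eq, h0]

/-- The rank of `T ^ r` measures whether `T' ^ s w` lies in the range of `T' ^ r`. -/
theorem finrank_range_le_iff [FiniteDimensional ℂ V] (h : IsCyclicExtension ι T' T x k w)
    {r s : ℕ} (hr : r ≤ k + s) :
    finrank ℂ (LinearMap.range (T ^ r)) ≤ finrank ℂ (LinearMap.range (T' ^ r)) + (k + s - r) ↔
      (T' ^ s) w ∈ LinearMap.range (T' ^ r) := by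
  rw [← h.pow_mem_iff, ← h.finrank_map_range]
  refine ⟨fun hle => ?_, finrank_range_pow_le_of_mem h.invariant h.span hr⟩
  by_contra hx
  have := finrank_range_pow_ge_of_notMem h.isNilpotent h.invariant h.span hr hx
  omega

theorem le_finrank_range [FiniteDimensional ℂ V] (h : IsCyclicExtension ι T' T x k w) {r : ℕ} :
    finrank ℂ (LinearMap.range (T' ^ r)) + (k - r) ≤ finrank ℂ (LinearMap.range (T ^ r)) := by
  rcases le_or_gt k r with hr | hr
  · rw [Nat.sub_eq_zero_of_le hr, add_zero, ← h.finrank_map_range]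
    exact Submodule.finrank_mono LinearMap.map_le_range
  · have hx : (T ^ (k - 1)) x ∉ (LinearMap.range ι).map (T ^ r) := by
      rw [h.map_range]
      exact fun hmem => h.pow_notMem (k - 1) (by omega)
        (LinearMap.map_le_range hmem)
    have := finrank_range_pow_ge_of_notMem h.isNilpotent h.invariant h.span (by omega) hx
    rw [h.finrank_map_range] at this
    omega

end IsCyclicExtension

/-! ### Nilpotent Jordan matrices -/

section Jordan

variable {l : ℕ} {ν : Fin l → ℕ}

/-- The coordinates of a vector indexed by boxes, extended by zero beyond the end of each block. -/
def extend (u : Box ν → ℂ) (i : Fin l) (a : ℕ) : ℂ := if h : a < ν i then u ⟨i, a, h⟩ else 0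

lemma extend_coe (u : Box ν → ℂ) (p : Box ν) : extend u p.1 p.2 = u p := by
  simp [extend]

lemma extend_of_le (u : Box ν → ℂ) {i : Fin l} {a : ℕ} (h : ν i ≤ a) : extend u i a = 0 := by
  simp [extend, h.not_gt]

lemma jordan_mulVec (u : Box ν → ℂ) (p : Box ν) :
    (jordan ν *ᵥ u) p = extend u p.1 (p.2 + 1) := by
  obtain ⟨i, a⟩ := p
  rw [Matrix.mulVec, dotProduct]
  by_cases h : (a : ℕ) + 1 < ν i
  · rw [Finset.sum_eq_single ⟨i, a + 1, h⟩]
    · simp [jordan, extend, h]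
    · rintro ⟨j, b⟩ - hne
      rw [jordan, if_neg, zero_mul]
      rintro ⟨h1, h2⟩
      dsimp at h1 h2
      subst h1
      exact hne (by ext <;> simp [h2])
    · simp
  · rw [extend, dif_neg h]
    refine Finset.sum_eq_zero fun q _ => ?_
    obtain ⟨j, b⟩ := q
    rw [jordan, if_neg, zero_mul]
    rintro ⟨h1, h2⟩
    dsimp at h1 h2
    subst h1
    have := b.2
    omega

lemma extend_jordan_pow_mulVec (r : ℕ) (u : Box ν → ℂ) (i : Fin l) (a : ℕ) :
    extend (jordan ν ^ r *ᵥ u) i a = extend u i (a + r) := by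
  induction r generalizing a with
  | zero => simp
  | succ r ih =>
    by_cases h : a < ν i
    · rw [pow_succ', ← Matrix.mulVec_mulVec]
      conv_lhs => rw [extend, dif_pos h]
      rw [jordan_mulVec, ih]
      congr 1
      simp only
      omega
    · rw [extend_of_le _ (by omega), extend_of_le _ (by omega)]

lemma jordan_pow_mulVec (r : ℕ) (u : Box ν → ℂ) (p : Box ν) :
    (jordan ν ^ r *ᵥ u) p = extend u p.1 (p.2 + r) := by
  rw [← extend_coe (jordan ν ^ r *ᵥ u), extend_jordan_pow_mulVec]

lemma mem_range_jordan_pow_iff (r : ℕ) (u : Box ν → ℂ) :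
    u ∈ LinearMap.range ((jordan ν) ^ r).mulVecLin ↔
      ∀ i a, ν i ≤ a + r → extend u i a = 0 := by
  constructor
  · rintro ⟨v, rfl⟩ i a h
    rw [Matrix.mulVecLin_apply, extend_jordan_pow_mulVec, extend_of_le _ h]
  · intro h
    refine ⟨fun p => if r ≤ (p.2 : ℕ) then extend u p.1 (p.2 - r) else 0, ?_⟩
    ext p
    rw [Matrix.mulVecLin_apply, jordan_pow_mulVec]
    by_cases hp : (p.2 : ℕ) + r < ν p.1
    · rw [extend, dif_pos hp, if_pos (by simp)]
      simpa using extend_coe u p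
    · rw [extend, dif_neg hp, ← extend_coe u p, h _ _ (by omega)]

lemma rank_jordan_pow (r : ℕ) : (jordan ν ^ r).rank = ∑ i, (ν i - r) := by
  let R : (Box ν → ℂ) →ₗ[ℂ] ((Σ i, Fin (ν i - r)) → ℂ) :=
    LinearMap.funLeft ℂ ℂ fun q => ⟨q.1, q.2, by omega⟩
  have hbij : Function.Bijective (R.domRestrict (LinearMap.range (jordan ν ^ r).mulVecLin)) := by
    constructor
    · rw [← LinearMap.ker_eq_bot, LinearMap.ker_eq_bot']
      rintro ⟨u, hu⟩ h0
      refine Subtype.ext (funext fun p => ?_)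
      by_cases hp : (p.2 : ℕ) < ν p.1 - r
      · exact congrFun h0 ⟨p.1, p.2, hp⟩
      · change u p = 0
        rw [← extend_coe u]
        exact (mem_range_jordan_pow_iff r u).1 hu _ _ (by omega)
    · intro v
      let u : Box ν → ℂ := fun p => if h : (p.2 : ℕ) < ν p.1 - r then v ⟨p.1, p.2, h⟩ else 0
      have hu : u ∈ LinearMap.range (jordan ν ^ r).mulVecLin := by
        rw [mem_range_jordan_pow_iff]
        intro i a h
        rw [extend]
        split_ifs with h'
        · exact dif_neg (by simp only; omega)
        · rfl
      exact ⟨⟨u, hu⟩, funext fun q => by simp [R, u, LinearMap.funLeft]⟩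
  rw [Matrix.rank, (LinearEquiv.ofBijective _ hbij).finrank_eq]
  simp

end Jordan

/-! ### Conjugacy classes of nilpotent matrices and ranks of powers -/

section Classification

open Module Polynomial

lemma exists_basis_quotient_X_pow (k : ℕ) :
    ∃ b : Basis (Fin k) ℂ (ℂ[X] ⧸ Submodule.span ℂ[X] {(X : ℂ[X]) ^ k}),
      ∀ a, b a = Submodule.Quotient.mk (X ^ (k - 1 - a)) := by
  have h0 : ∀ j, AdjoinRoot.powerBasisAux' (monic_X_pow (R := ℂ) k) j =
      AdjoinRoot.mk (X ^ k) (X ^ (j : ℕ)) := by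
    intro j
    rw [map_pow, AdjoinRoot.mk_X]
    exact (AdjoinRoot.powerBasis' (monic_X_pow (R := ℂ) k)).basis_eq_pow j
  let b : Basis (Fin k) ℂ (AdjoinRoot ((X : ℂ[X]) ^ k)) :=
    (AdjoinRoot.powerBasisAux' (monic_X_pow k)).reindex
      ((finCongr (natDegree_X_pow k)).trans Fin.revPerm)
  have hb : ∀ a, b a = AdjoinRoot.mk (X ^ k) (X ^ (k - 1 - a)) := by
    intro a
    rw [Basis.reindex_apply, h0]
    congr 2
    simp
    omega
  exact ⟨b, hb⟩

/-- A nilpotent matrix has a Jordan form: the module over the polynomial ring that it defines is a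
sum of modules `ℂ[X] / X ^ k`, with bases formed by powers of `X`. -/
lemma exists_jordan_basis {V : Type} [AddCommGroup V] [Module ℂ V] [FiniteDimensional ℂ V]
    {T : End ℂ V} (hT : IsNilpotent T) :
    ∃ (l : ℕ) (ν : Fin l → ℕ) (b : Basis (Box ν) ℂ V), ∀ p : Box ν,
      T (b p) = ∑ q, jordan ν q p • b q := by
  obtain ⟨K, hK⟩ := hT
  have htors : Module.IsTorsion' (AEval' T) (Submonoid.powers (X : ℂ[X])) := by
    intro x
    refine ⟨⟨X ^ K, K, rfl⟩, ?_⟩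
    obtain ⟨v, rfl⟩ := (AEval'.of T).surjective x
    change (X ^ K : ℂ[X]) • AEval'.of T v = 0
    rw [AEval'.X_pow_smul_of, hK]
    simp
  obtain ⟨l, ν, ⟨Φ⟩⟩ := torsion_by_prime_power_decomposition irreducible_X htors
  let y : Fin l → ℕ → V := fun i k => (AEval'.of T).symm (Φ.symm (DirectSum.lof ℂ[X] (Fin l)
    (fun i => ℂ[X] ⧸ Submodule.span ℂ[X] {(X : ℂ[X]) ^ ν i}) i (Submodule.Quotient.mk (X ^ k))))
  have hTy : ∀ i k, T (y i k) = y i (k + 1) := by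
    intro i k
    simp only [y]
    rw [← AEval'.of_symm_X_smul, ← map_smul, ← map_smul, ← Submodule.Quotient.mk_smul, pow_succ',
      smul_eq_mul]
  have hy0 : ∀ i k, ν i ≤ k → y i k = 0 := by
    intro i k hk
    have : (Submodule.Quotient.mk (X ^ k) : ℂ[X] ⧸ Submodule.span ℂ[X] {(X : ℂ[X]) ^ ν i}) = 0 := by
      rw [Submodule.Quotient.mk_eq_zero]
      exact Ideal.mem_span_singleton.2 (pow_dvd_pow _ hk)
    simp only [y, this, map_zero]
  have hb : ∃ b : Basis (Box ν) ℂ V, ∀ p, b p = y p.1 (ν p.1 - 1 - p.2) := by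
    choose b₀ hb₀ using fun i => exists_basis_quotient_X_pow (ν i)
    refine ⟨(((Pi.basis b₀).map (DirectSum.linearEquivFunOnFintype ℂ (Fin l) _).symm).map
      (Φ.restrictScalars ℂ).symm).map (AEval'.of T).symm, fun p => ?_⟩
    rw [Basis.map_apply, Basis.map_apply, Basis.map_apply, Pi.basis_apply, hb₀]
    simp only [y]
    congr 1
    change Φ.symm _ = Φ.symm _
    congr 1
    exact DirectSum.linearEquivFunOnFintype_symm_single ..
  obtain ⟨b, hb⟩ := hb
  refine ⟨l, ν, b, fun p => ?_⟩
  rw [hb, hTy]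
  by_cases hp : (p.2 : ℕ) = 0
  · rw [hy0 _ _ (by omega)]
    refine (Finset.sum_eq_zero fun q _ => ?_).symm
    rw [jordan, if_neg (by omega), zero_smul]
  · obtain ⟨i, a⟩ := p
    rw [Finset.sum_eq_single ⟨i, a - 1, by omega⟩]
    · rw [jordan, if_pos ⟨rfl, by simp only at hp ⊢; omega⟩, one_smul, hb]
      have ha := a.2
      change (a : ℕ) ≠ 0 at hp
      change y i (ν i - 1 - a + 1) = y i (ν i - 1 - (a - 1 : ℕ))
      congr 1
      omega
    · rintro ⟨j, c⟩ - hne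
      rw [jordan, if_neg, zero_smul]
      rintro ⟨h1, h2⟩
      dsimp at h1 h2
      subst h1
      exact hne (Sigma.ext rfl (heq_of_eq (Fin.ext (by change (c : ℕ) = a - 1; omega))))
    · simp

/-- The number of boxes of the Young diagram `lam` outside the first `r` columns. -/
def colTail (lam : YoungDiagram) (r : ℕ) : ℕ := ∑ i, (rows lam i - r)

lemma rows_pos (lam : YoungDiagram) (i : Fin (lam.colLen 0)) : 0 < rows lam i :=
  YoungDiagram.mem_iff_lt_rowLen.1 (YoungDiagram.mem_iff_lt_colLen.2 i.2)

/-- A family of natural numbers is determined, up to the order and zeros, by the sums of its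
truncated differences. -/
lemma exists_equiv_of_sum_sub_eq {a b : Type} [Fintype a] [Fintype b] {f : a → ℕ} {g : b → ℕ}
    (hg : ∀ j, 0 < g j) (h : ∀ r, ∑ i, (f i - r) = ∑ j, (g j - r)) :
    ∃ φ : {i // 0 < f i} ≃ b, ∀ i, g (φ i) = f i := by
  classical
  have hcount : ∀ {c : Type} [Fintype c] (f : c → ℕ) (r : ℕ),
      ∑ i, (f i - r) = ∑ i, (f i - (r + 1)) + (Finset.univ.filter fun i => r < f i).card := by
    intro c _ f r
    rw [Finset.card_filter, ← Finset.sum_add_distrib]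
    exact Finset.sum_congr rfl fun i _ => by split_ifs <;> omega
  have hgt : ∀ r, (Finset.univ.filter fun i => r < f i).card =
      (Finset.univ.filter fun j => r < g j).card := by
    intro r
    have h1 := hcount f r
    have h2 := hcount g r
    rw [h r, h (r + 1)] at h1
    omega
  have hsplit : ∀ {c : Type} [Fintype c] (f : c → ℕ) (r : ℕ),
      (Finset.univ.filter fun i => r < f i).card = (Finset.univ.filter fun i => r + 1 < f i).card +
        (Finset.univ.filter fun i => f i = r + 1).card := by
    intro c _ f r
    rw [Finset.card_filter, Finset.card_filter, Finset.card_filter, ← Finset.sum_add_distrib]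
    exact Finset.sum_congr rfl fun i _ => by split_ifs <;> omega
  have heq : ∀ s, Nonempty ({i : {i // 0 < f i} // f i = s} ≃ {j // g j = s}) := by
    rintro (_ | s)
    · have : IsEmpty {i : {i // 0 < f i} // f i = 0} := ⟨fun i => i.1.2.ne' i.2⟩
      have : IsEmpty {j // g j = 0} := ⟨fun j => (hg j.1).ne' j.2⟩
      exact ⟨Equiv.equivOfIsEmpty _ _⟩
    · have e : {i : {i // 0 < f i} // f i = s + 1} ≃ {i // f i = s + 1} :=
        Equiv.subtypeSubtypeEquivSubtype (p := fun i => 0 < f i) (q := fun i => f i = s + 1)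
          fun h => by omega
      refine ⟨e.trans (Fintype.equivOfCardEq ?_)⟩
      rw [Fintype.card_subtype, Fintype.card_subtype]
      have h1 := hsplit f s
      have h2 := hsplit g s
      rw [hgt s, hgt (s + 1)] at h1
      omega
  let e := fun s => (heq s).some
  refine ⟨(Equiv.sigmaFiberEquiv fun i : {i // 0 < f i} => f i).symm.trans
    ((Equiv.sigmaCongrRight e).trans (Equiv.sigmaFiberEquiv g)), fun i => ?_⟩
  exact (e (f i) ⟨i, rfl⟩).2

variable {n : Type} [Fintype n] [DecidableEq n]

lemma rank_pow_of_conj {A B : Matrix n n ℂ} {g : (Matrix n n ℂ)ˣ} (h : A * g = g * B) (r : ℕ) :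
    (A ^ r).rank = (B ^ r).rank := by
  have hg : IsUnit (g : Matrix n n ℂ).det := (Matrix.isUnit_iff_isUnit_det _).1 g.isUnit
  have hpow : A ^ r * g = g * B ^ r := by
    have : SemiconjBy (g : Matrix n n ℂ) B A := h.symm
    exact ((this.pow_right r)).symm
  rw [← Matrix.rank_mul_eq_left_of_isUnit_det _ (A ^ r) hg, hpow,
    Matrix.rank_mul_eq_right_of_isUnit_det _ _ hg]

lemma rank_reindex_jordan_pow {l : ℕ} {ν : Fin l → ℕ} (e : Box ν ≃ n) (r : ℕ) :
    (Matrix.reindex e e (jordan ν) ^ r).rank = ∑ i, (ν i - r) := by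
  rw [← Matrix.coe_reindexAlgEquiv ℂ ℂ e, ← map_pow, Matrix.coe_reindexAlgEquiv,
    Matrix.rank_reindex, rank_jordan_pow]

lemma exists_conj_of_basis {A : Matrix n n ℂ} {l : ℕ} {ν : Fin l → ℕ} (b : Basis (Box ν) ℂ (n → ℂ))
    (hb : ∀ p, Matrix.toLin' A (b p) = ∑ q, jordan ν q p • b q) (e : Box ν ≃ n) :
    ∃ g : (Matrix n n ℂ)ˣ, A * g = g * Matrix.reindex e e (jordan ν) := by
  let B := (Pi.basisFun ℂ n).toMatrix (b.reindex e)
  have : Invertible B := (Pi.basisFun ℂ n).invertibleToMatrix (b.reindex e)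
  refine ⟨unitOfInvertible B, ?_⟩
  rw [val_unitOfInvertible]
  have hB : ∀ i j, B i j = b (e.symm j) i := fun i j => by simp [B, Basis.toMatrix_apply]
  ext i j
  have h := congrFun (hb (e.symm j)) i
  rw [Matrix.toLin'_apply, Matrix.mulVec, dotProduct, Finset.sum_apply] at h
  simp only [Matrix.mul_apply, hB, h, Pi.smul_apply, smul_eq_mul, Matrix.reindex_apply,
    Matrix.submatrix_apply]
  rw [← e.symm.sum_comp]
  exact Finset.sum_congr rfl fun q _ => mul_comm _ _

lemma isNilpotent_of_rank {A : Matrix n n ℂ} {lam : YoungDiagram}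
    (h : ∀ r, (A ^ r).rank = colTail lam r) : IsNilpotent A := by
  refine ⟨∑ i, rows lam i, ?_⟩
  have h0 : (A ^ ∑ i, rows lam i).rank = 0 := by
    rw [h]
    refine Finset.sum_eq_zero fun i hi => Nat.sub_eq_zero_of_le ?_
    exact Finset.single_le_sum (f := rows lam) (fun _ _ => Nat.zero_le _) hi
  rw [Matrix.rank, Submodule.finrank_eq_zero, LinearMap.range_eq_bot] at h0
  exact Matrix.ext_iff_mulVec.2 fun v => by
    rw [Matrix.zero_mulVec]; exact LinearMap.congr_fun h0 v

/-- A matrix whose powers have the ranks of those of the Jordan matrix of `lam` is conjugate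
to it. -/
theorem exists_conj_of_rank {A : Matrix n n ℂ} {lam : YoungDiagram}
    (h : ∀ r, (A ^ r).rank = colTail lam r) (e : Box (rows lam) ≃ n) :
    ∃ g : (Matrix n n ℂ)ˣ, A * g = g * Matrix.reindex e e (jordan (rows lam)) := by
  have hnil : IsNilpotent (Matrix.toLin' A) := by
    obtain ⟨K, hK⟩ := isNilpotent_of_rank h
    exact ⟨K, by rw [← Matrix.toLin'_pow, hK, map_zero]⟩
  obtain ⟨l, ν, b, hb⟩ := exists_jordan_basis hnil
  have hcard : Fintype.card (Box ν) = Fintype.card n := by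
    rw [← Module.finrank_eq_card_basis b, Module.finrank_fintype_fun_eq_card]
  have hsum : ∀ r, ∑ i, (ν i - r) = ∑ j, (rows lam j - r) := by
    intro r
    obtain ⟨g, hg⟩ := exists_conj_of_basis b hb (Fintype.equivOfCardEq hcard)
    rw [← rank_reindex_jordan_pow (Fintype.equivOfCardEq hcard) r, ← rank_pow_of_conj hg, h,
      colTail]
  obtain ⟨φ, hφ⟩ := exists_equiv_of_sum_sub_eq (rows_pos lam) hsum
  let ψ : Box ν ≃ Box (rows lam) :=
    { toFun := fun p => ⟨φ ⟨p.1, p.2.pos⟩, p.2, by rw [hφ]; exact p.2.2⟩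
      invFun := fun q => ⟨φ.symm q.1, q.2, by
        rw [← hφ, Equiv.apply_symm_apply]; exact q.2.2⟩
      left_inv := fun p => by
        refine Sigma.ext (by simp) ?_
        rw [Fin.heq_ext_iff (by simp)]
      right_inv := fun q => by
        refine Sigma.ext (by simp) ?_
        rw [Fin.heq_ext_iff (by simp)] }
  have hψ : ∀ p q, jordan (rows lam) (ψ p) (ψ q) = jordan ν p q := by
    intro p q
    have h1 : (ψ p).1 = (ψ q).1 ↔ p.1 = q.1 := by
      simp [ψ, Subtype.ext_iff]
    simp only [jordan, h1]
    rfl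
  obtain ⟨g, hg⟩ := exists_conj_of_basis b hb (ψ.trans e)
  refine ⟨g, ?_⟩
  rw [hg]
  congr 1
  ext i j
  simp only [Matrix.reindex_apply, Matrix.submatrix_apply, ← hψ]
  simp

lemma card_box_rows (lam : YoungDiagram) : Fintype.card (Box (rows lam)) = colTail lam 0 := by
  simp [colTail]

/-- The conjugacy class of `J_lam` is given by the ranks of the powers. -/
theorem mem_orbit_iff {A : Matrix n n ℂ} {lam : YoungDiagram} :
    A ∈ orbit n lam ↔ ∀ r, (A ^ r).rank = colTail lam r := by
  constructor
  · rintro ⟨e, g, rfl⟩ r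
    rw [colTail, ← rank_reindex_jordan_pow e r]
    exact rank_pow_of_conj (g := g) (by simp [mul_assoc]) r
  · intro h
    have hcard : Fintype.card (Box (rows lam)) = Fintype.card n := by
      rw [card_box_rows, ← h 0, pow_zero, Matrix.rank_one]
    let e := Fintype.equivOfCardEq hcard
    obtain ⟨g, hg⟩ := exists_conj_of_rank h e
    exact ⟨e, g, by rw [← hg, mul_assoc, Units.mul_inv, mul_one]⟩

end Classification

/-- The rank of a regular family of matrices is lower semicontinuous. -/
lemma isOpen_le_rank {σ a b : Type} [Fintype a] [Fintype b] [DecidableEq a] [DecidableEq b]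
    {M : Aff σ → Matrix a b ℂ} (hM : RegularMatOn Set.univ M) (k : ℕ) :
    IsOpen {x | k ≤ (M x).rank} := by
  rw [isOpen_iff_ev]
  intro x₀ hx₀
  obtain ⟨v, hv⟩ : ∃ v : Fin k → (b → ℂ), LinearIndependent ℂ fun i => (M x₀) *ᵥ v i := by
    obtain ⟨f, hf⟩ := exists_linearIndependent_of_le_finrank (R := ℂ)
      (M := LinearMap.range (M x₀).mulVecLin) (n := k) hx₀
    choose v hv using fun i => (f i).2
    refine ⟨v, ?_⟩
    have := hf.map' (LinearMap.range (M x₀).mulVecLin).subtype (by simp)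
    have h2 : (fun i => M x₀ *ᵥ v i) = (LinearMap.range (M x₀).mulVecLin).subtype ∘ f :=
      funext hv
    rwa [h2]
  obtain ⟨p, hp⟩ : ∃ p : (a → ℂ) →ₗ[ℂ] (Fin k → ℂ), ∀ i, p (M x₀ *ᵥ v i) = Pi.single i 1 := by
    obtain ⟨p, hp⟩ := LinearMap.exists_extend (Module.Basis.span hv).equivFun.toLinearMap
    refine ⟨p, fun i => ?_⟩
    have := LinearMap.congr_fun hp (Module.Basis.span hv i)
    rw [LinearMap.comp_apply, Submodule.subtype_apply, Module.Basis.span_apply] at this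
    rw [this]
    ext j
    simp [Finsupp.single_apply, Pi.single_apply, eq_comm]
  let N : Aff σ → Matrix (Fin k) (Fin k) ℂ := fun x =>
    LinearMap.toMatrix' p * (M x * Matrix.of fun i j => v j i)
  have hN : RegularMatOn Set.univ N := (RegularMatOn.const _).mul (hM.mul (RegularMatOn.const _))
  have hN₀ : N x₀ = 1 := by
    ext i j
    have := congrFun (hp j) i
    rw [← LinearMap.toMatrix'_mulVec] at this
    rw [Matrix.one_apply, ← Pi.single_apply, ← this]
    rfl
  obtain ⟨d, hd⟩ := hN.det.exists_poly_ne_zero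
  refine ⟨d, (hd x₀ trivial).1 (by simp [hN₀]), fun y hy => ?_⟩
  have h1 := Matrix.rank_of_det_ne_zero (A := N y) ((hd y trivial).2 hy)
  rw [Fintype.card_fin] at h1
  change k ≤ (M y).rank
  rw [← h1]
  exact (Matrix.rank_mul_le_right _ _).trans (Matrix.rank_mul_le_left _ _)

/-! ### Horizontal strips -/

/-- The sequences `a ≤ b` of row lengths of two Young diagrams with at most `M` rows differ by
a horizontal strip: no two of the added boxes are in the same column. -/
structure IsHorizontalStrip (a b : ℕ → ℕ) (M : ℕ) : Prop where
  le : ∀ i, a i ≤ b i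
  succ_le : ∀ i, b (i + 1) ≤ a i
  eq_zero : ∀ i, M ≤ i → b i = 0

/-- The number of boxes of the strip between `a` and `b` in the first `r` columns. -/
def stripBefore (a b : ℕ → ℕ) (M r : ℕ) : ℕ := ∑ i ∈ Finset.range M, (min (b i) r - min (a i) r)

namespace IsHorizontalStrip

variable {a b : ℕ → ℕ} {M : ℕ}

lemma b_anti (h : IsHorizontalStrip a b M) : Antitone b :=
  antitone_nat_of_succ_le fun i => (h.succ_le i).trans (h.le i)

lemma a_anti (h : IsHorizontalStrip a b M) : Antitone a :=
  antitone_nat_of_succ_le fun i => (h.le (i + 1)).trans (h.succ_le i)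

lemma b_le_a (h : IsHorizontalStrip a b M) {i j : ℕ} (hij : i < j) : b j ≤ a i :=
  (h.b_anti hij).trans (h.succ_le i)

/-- The intervals from `a i` to `b i` are disjoint, so that their images under a monotone function
have total length at most that of the image of the interval from `0` to `b 0`. -/
lemma sum_sub_le (h : IsHorizontalStrip a b M) {f : ℕ → ℕ} (hf : Monotone f) (n : ℕ) :
    ∑ i ∈ Finset.range n, (f (b i) - f (a i)) + f (b n) ≤ f (b 0) := by
  induction n with
  | zero => simp
  | succ n ih =>
    rw [Finset.sum_range_succ]
    have h1 := hf (h.le n)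
    have h2 := hf (h.succ_le n)
    omega

lemma stripBefore_le (h : IsHorizontalStrip a b M) (r : ℕ) : stripBefore a b M r ≤ r := by
  have := h.sum_sub_le (f := fun x => min x r) (fun x y hxy => min_le_min_right _ hxy) M
  rw [stripBefore]
  omega

lemma stripBefore_mono : Monotone (stripBefore a b M) := fun r s hrs => by
  refine Finset.sum_le_sum fun i _ => ?_
  omega

lemma stripBefore_add_le (h : IsHorizontalStrip a b M) {r s : ℕ} (hrs : r ≤ s) :
    stripBefore a b M s + r ≤ stripBefore a b M r + s := by
  have h1 := h.sum_sub_le (f := fun x => min x s - min x r) (fun x y hxy => by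
    dsimp only; omega) M
  have h2 : stripBefore a b M s = stripBefore a b M r +
      ∑ i ∈ Finset.range M, ((min (b i) s - min (b i) r) - (min (a i) s - min (a i) r)) := by
    rw [stripBefore, stripBefore, ← Finset.sum_add_distrib]
    refine Finset.sum_congr rfl fun i _ => ?_
    have := h.le i
    omega
  omega

lemma sum_tail (h : IsHorizontalStrip a b M) (r : ℕ) :
    ∑ i ∈ Finset.range M, (b i - r) + stripBefore a b M r =
      ∑ i ∈ Finset.range M, (a i - r) + ∑ i ∈ Finset.range M, (b i - a i) := by
  rw [stripBefore, ← Finset.sum_add_distrib, ← Finset.sum_add_distrib]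
  refine Finset.sum_congr rfl fun i _ => ?_
  have := h.le i
  omega

lemma stripBefore_le_sum (h : IsHorizontalStrip a b M) (r : ℕ) :
    stripBefore a b M r ≤ ∑ i ∈ Finset.range M, (b i - a i) := by
  refine Finset.sum_le_sum fun i _ => ?_
  have := h.le i
  omega

lemma stripBefore_a (h : IsHorizontalStrip a b M) (i : ℕ) :
    stripBefore a b M (a i) = ∑ j ∈ Finset.range M, if i < j then b j - a j else 0 := by
  refine Finset.sum_congr rfl fun j _ => ?_
  split_ifs with hij
  · have := h.b_le_a hij
    have := h.le j
    omega
  · have := h.a_anti (not_lt.1 hij)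
    have := h.le j
    omega

/-- Each box of the strip in the row `j` is to the left of the ends of the `j` rows above it. -/
lemma sum_stripBefore_a (h : IsHorizontalStrip a b M) :
    ∑ i ∈ Finset.range M, stripBefore a b M (a i) =
      ∑ j ∈ Finset.range M, j * (b j - a j) := by
  simp only [h.stripBefore_a]
  rw [Finset.sum_comm]
  refine Finset.sum_congr rfl fun j hj => ?_
  have : (Finset.range M).filter (fun i => i < j) = Finset.range j := by
    ext i
    simp only [Finset.mem_filter, Finset.mem_range] at hj ⊢
    omega
  rw [← Finset.sum_filter, this]
  simp

/-- If the strip has boxes beyond the first `r` columns, some row length `a i` satisfies, with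
`D = stripBefore a b M`, both `D (a i) ≤ D r` and `r - D r ≤ a i - D (a i)`. The witness is the last
row for which `b` reaches beyond the column `r`. -/
lemma exists_row (h : IsHorizontalStrip a b M) {r : ℕ}
    (hr : stripBefore a b M r < ∑ i ∈ Finset.range M, (b i - a i)) :
    ∃ i < M, stripBefore a b M (a i) ≤ stripBefore a b M r ∧
      r + stripBefore a b M (a i) ≤ a i + stripBefore a b M r := by
  classical
  have hex : ∃ j, b j ≤ r := ⟨M, by rw [h.eq_zero M le_rfl]; exact Nat.zero_le _⟩
  obtain ⟨j, hj, hmin⟩ : ∃ j, b j ≤ r ∧ ∀ i < j, r < b i :=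
    ⟨Nat.find hex, Nat.find_spec hex, fun i hi => not_le.1 (Nat.find_min hex hi)⟩
  rcases j with _ | i
  · exfalso
    refine hr.not_ge (Finset.sum_le_sum fun i _ => ?_)
    have := h.b_anti (Nat.zero_le i)
    have := h.le i
    omega
  have hbi := hmin i (Nat.lt_succ_self i)
  have hiM : i < M := by
    by_contra hM
    rw [h.eq_zero i (not_lt.1 hM)] at hbi
    omega
  refine ⟨i, hiM, ?_⟩
  rcases le_or_gt (a i) r with hai | hai
  · refine ⟨stripBefore_mono hai, ?_⟩
    have h1 : ∀ j ∈ Finset.range M, (min (b j) (a i) - min (a j) (a i)) +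
        (if j = i then r - a i else 0) ≤ min (b j) r - min (a j) r := by
      intro j _
      split_ifs with hji
      · subst hji
        omega
      · have := h.le j
        omega
    have h2 := Finset.sum_le_sum h1
    rw [Finset.sum_add_distrib, Finset.sum_ite_eq' , if_pos (Finset.mem_range.2 hiM)] at h2
    rw [stripBefore, stripBefore]
    omega
  · have h1 : stripBefore a b M (a i) = stripBefore a b M r := by
      refine Finset.sum_congr rfl fun j _ => ?_
      rcases le_or_gt j i with hji | hji
      · have := h.a_anti hji
        have := h.le j
        omega
      · have := h.b_anti (show i + 1 ≤ j from hji)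
        have := h.le j
        omega
    rw [h1]
    omega

end IsHorizontalStrip

lemma rowLen_eq_zero {lam : YoungDiagram} {i : ℕ} (h : lam.colLen 0 ≤ i) : lam.rowLen i = 0 := by
  by_contra h0
  exact h.not_gt (YoungDiagram.mem_iff_lt_colLen.1
    (YoungDiagram.mem_iff_lt_rowLen.2 (Nat.pos_of_ne_zero h0)))

lemma sum_rows {lam : YoungDiagram} {M : ℕ} (hM : lam.colLen 0 ≤ M) {f : ℕ → ℕ} (hf : f 0 = 0) :
    ∑ i, f (rows lam i) = ∑ i ∈ Finset.range M, f (lam.rowLen i) := by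
  rw [← Finset.sum_subset (Finset.range_mono hM) fun i _ hi => ?_, Finset.sum_range]
  · rfl
  · rw [rowLen_eq_zero (by simpa using hi), hf]

lemma colTail_eq {lam : YoungDiagram} {M : ℕ} (hM : lam.colLen 0 ≤ M) (r : ℕ) :
    colTail lam r = ∑ i ∈ Finset.range M, (lam.rowLen i - r) :=
  sum_rows hM (f := fun x => x - r) (Nat.zero_sub r)

/-! ### The extensions of a given Jordan type -/

section Strip

variable {kap lam : YoungDiagram} {M : ℕ}

/-- The vectors that define extensions of type at most `lam` of the Jordan matrix of `kap`: in
each block, as many of the last coordinates vanish as the strip has boxes to the left of the end of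
the row. -/
def IsGood (lam : YoungDiagram) (M : ℕ) (u : Box (rows kap) → ℂ) : Prop :=
  ∀ p : Box (rows kap), rows kap p.1 ≤ p.2 + stripBefore kap.rowLen lam.rowLen M (rows kap p.1) →
    u p = 0

lemma isGood_iff_extend {u : Box (rows kap) → ℂ} : IsGood lam M u ↔
    ∀ i a, rows kap i ≤ a + stripBefore kap.rowLen lam.rowLen M (rows kap i) →
      extend u i a = 0 := by
  constructor
  · intro h i a hle
    rw [extend]
    split_ifs with ha
    exacts [h ⟨i, a, ha⟩ hle, rfl]
  · intro h p hp
    rw [← extend_coe u, h _ _ hp]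

/-- Only the conditions where `r` is the length of a row matter, because `stripBefore` and
`r - stripBefore r` are both monotone in `r`. -/
lemma isGood_iff_mem_range (h : IsHorizontalStrip kap.rowLen lam.rowLen M)
    {u : Box (rows kap) → ℂ} : IsGood lam M u ↔
      ∀ r, jordan (rows kap) ^ (r - stripBefore kap.rowLen lam.rowLen M r) *ᵥ u ∈
        LinearMap.range (jordan (rows kap) ^ r).mulVecLin := by
  rw [isGood_iff_extend]
  simp only [mem_range_jordan_pow_iff, extend_jordan_pow_mulVec]
  constructor
  · intro hu r i a hle
    refine hu i _ ?_
    have h1 := h.stripBefore_le r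
    rcases le_total r (rows kap i) with hr | hr
    · have := IsHorizontalStrip.stripBefore_mono (a := kap.rowLen) (b := lam.rowLen) (M := M) hr
      omega
    · have := h.stripBefore_add_le hr
      omega
  · intro hu i a hle
    have h1 := h.stripBefore_le (rows kap i)
    have := hu (rows kap i) i
      (a - (rows kap i - stripBefore kap.rowLen lam.rowLen M (rows kap i))) (by omega)
    rwa [Nat.sub_add_cancel (by omega)] at this

open Module

variable {n n' : Type} [Fintype n] [DecidableEq n] [Fintype n'] [DecidableEq n']
  {ι : (n' → ℂ) →ₗ[ℂ] (n → ℂ)} {A : Matrix n' n' ℂ} {B : Matrix n n ℂ} {x : n → ℂ} {k : ℕ}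
  {P : Matrix n' (Box (rows kap)) ℂ} {Q : Matrix (Box (rows kap)) n' ℂ}
  {u : Box (rows kap) → ℂ}

lemma finrank_range_toLin'_pow (B : Matrix n n ℂ) (r : ℕ) :
    finrank ℂ (LinearMap.range (Matrix.toLin' B ^ r)) = (B ^ r).rank := by
  rw [← Matrix.toLin'_pow]
  rfl

lemma pow_mulVec_mem_range_iff (hPQ : P * Q = 1) (hQP : Q * P = 1)
    (hA : A * P = P * jordan (rows kap)) (s r : ℕ) :
    (Matrix.toLin' A ^ s) (P *ᵥ u) ∈ LinearMap.range (Matrix.toLin' A ^ r) ↔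
      jordan (rows kap) ^ s *ᵥ u ∈ LinearMap.range (jordan (rows kap) ^ r).mulVecLin := by
  have hpow : ∀ s, A ^ s * P = P * jordan (rows kap) ^ s := by
    intro s
    induction s with
    | zero => simp
    | succ s ih => rw [pow_succ, pow_succ, Matrix.mul_assoc, hA, ← Matrix.mul_assoc, ih,
        Matrix.mul_assoc]
  simp only [← Matrix.toLin'_pow, LinearMap.mem_range, Matrix.toLin'_apply, Matrix.mulVecLin_apply]
  rw [Matrix.mulVec_mulVec, hpow, ← Matrix.mulVec_mulVec]
  constructor
  · rintro ⟨y, hy⟩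
    refine ⟨Q *ᵥ y, ?_⟩
    have h1 : y = P *ᵥ (Q *ᵥ y) := by rw [Matrix.mulVec_mulVec, hPQ, Matrix.one_mulVec]
    rw [h1, Matrix.mulVec_mulVec, hpow, ← Matrix.mulVec_mulVec] at hy
    have h2 := congrArg (Q *ᵥ ·) hy
    simpa only [Matrix.mulVec_mulVec, ← Matrix.mul_assoc, hQP, Matrix.one_mul] using h2
  · rintro ⟨y, hy⟩
    exact ⟨P *ᵥ y, by rw [Matrix.mulVec_mulVec, hpow, ← Matrix.mulVec_mulVec, hy]⟩

/-- The matrix `B` is a cyclic extension of the matrix `A`, which is conjugate to the Jordan matrix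
of `kap` by `P` with inverse `Q`; the vector that defines the extension has coordinates `u` in the
Jordan basis. The Young diagrams `kap` and `lam` have at most `M` rows and differ by a horizontal
strip with `k` boxes. -/
structure IsStripExtension (kap lam : YoungDiagram) (M k : ℕ) (A : Matrix n' n' ℂ)
    (B : Matrix n n ℂ) (P : Matrix n' (Box (rows kap)) ℂ) (Q : Matrix (Box (rows kap)) n' ℂ)
    (ι : (n' → ℂ) →ₗ[ℂ] (n → ℂ)) (x : n → ℂ) (u : Box (rows kap) → ℂ) : Prop where
  strip : IsHorizontalStrip kap.rowLen lam.rowLen M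
  colLen_kap : kap.colLen 0 ≤ M
  colLen_lam : lam.colLen 0 ≤ M
  card_strip : k = ∑ i ∈ Finset.range M, (lam.rowLen i - kap.rowLen i)
  mul_inv : P * Q = 1
  inv_mul : Q * P = 1
  conj : A * P = P * jordan (rows kap)
  rank : ∀ r, (A ^ r).rank = colTail kap r
  ext : IsCyclicExtension ι (Matrix.toLin' A) (Matrix.toLin' B) x k (P *ᵥ u)

namespace IsStripExtension

lemma colTail_add (H : IsStripExtension kap lam M k A B P Q ι x u) (r : ℕ) :
    colTail lam r + stripBefore kap.rowLen lam.rowLen M r = colTail kap r + k := by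
  rw [colTail_eq H.colLen_kap, colTail_eq H.colLen_lam, H.strip.sum_tail, H.card_strip]

/-- The part of the condition for an extension to be of type `lam` that is linear in the vector that
defines the extension. -/
theorem rank_le_colTail_iff (H : IsStripExtension kap lam M k A B P Q ι x u) :
    (∀ r, (B ^ r).rank ≤ colTail lam r) ↔ IsGood lam M u := by
  have h3 := H.colTail_add
  obtain ⟨h, hkap, hlam, hk, hPQ, hQP, hA, hrank, hT⟩ := H
  rw [isGood_iff_mem_range h]
  refine forall_congr' fun r => ?_
  have h1 := h.stripBefore_le r
  have h2 := h.stripBefore_le_sum r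
  rw [← hk] at h2
  specialize h3 r
  rw [← pow_mulVec_mem_range_iff hPQ hQP hA, ← hT.finrank_range_le_iff (by omega),
    finrank_range_toLin'_pow, finrank_range_toLin'_pow, hrank]
  have h4 : colTail kap r + (k + (r - stripBefore kap.rowLen lam.rowLen M r) - r) =
      colTail lam r := by omega
  rw [h4]

/-- The extension is of type exactly `lam` if no coordinate among the last `k` ones of each block
vanishes that is not forced to. -/
theorem colTail_le_rank (H : IsStripExtension kap lam M k A B P Q ι x u)
    (hu : ∀ p : Box (rows kap),
      p.2 + stripBefore kap.rowLen lam.rowLen M (rows kap p.1) < rows kap p.1 →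
      rows kap p.1 ≤ p.2 + k → u p ≠ 0) (r : ℕ) :
    colTail lam r ≤ (B ^ r).rank := by
  have h3 := H.colTail_add r
  obtain ⟨h, hkap, hlam, hk, hPQ, hQP, hA, hrank, hT⟩ := H
  have h1 := h.stripBefore_le r
  have h2 := h.stripBefore_le_sum r
  have h5 := hT.le_finrank_range (r := r)
  rw [finrank_range_toLin'_pow, finrank_range_toLin'_pow, hrank] at h5
  rw [← hk] at h2
  by_contra! hlt
  set D := stripBefore kap.rowLen lam.rowLen M with hD
  have hDk : D r < k := by omega
  have hDr : D r < r := by omega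
  have hmem : (Matrix.toLin' A ^ (r - D r - 1)) (P *ᵥ u) ∈
      LinearMap.range (Matrix.toLin' A ^ r) := by
    rw [← hT.finrank_range_le_iff (by omega), finrank_range_toLin'_pow, finrank_range_toLin'_pow,
      hrank]
    omega
  rw [pow_mulVec_mem_range_iff hPQ hQP hA, mem_range_jordan_pow_iff] at hmem
  obtain ⟨i, hi, ha, hb⟩ := h.exists_row (r := r) (by rw [← hk]; exact hDk)
  rw [← hD] at ha hb
  have hi' : i < kap.colLen 0 := by
    by_contra hi'
    rw [rowLen_eq_zero (not_lt.1 hi')] at ha hb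
    omega
  let i' : Fin (kap.colLen 0) := ⟨i, hi'⟩
  have hrow : rows kap i' = kap.rowLen i := rfl
  -- the last coordinate of the block that is not forced to vanish
  let p : Box (rows kap) := ⟨i', kap.rowLen i - D (kap.rowLen i) - 1, by rw [hrow]; omega⟩
  refine hu p ?_ ?_ ?_
  · change kap.rowLen i - D (kap.rowLen i) - 1 + D (kap.rowLen i) < kap.rowLen i
    omega
  · change kap.rowLen i ≤ kap.rowLen i - D (kap.rowLen i) - 1 + k
    omega
  · have h6 := hmem i' (kap.rowLen i - D (kap.rowLen i) - 1 - (r - D r - 1)) (by rw [hrow]; omega)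
    rw [extend_jordan_pow_mulVec, Nat.sub_add_cancel (by omega)] at h6
    rw [← extend_coe u]
    exact h6

end IsStripExtension

end Strip

/-! ### The chain of shapes of a tableau -/

section Tableau

variable {lam : YoungDiagram} (τ : SemistandardYoungTableau lam)

/-- The shape formed by the letters `< j` of a tableau. -/
def shapeBelow : ℕ → YoungDiagram
  | 0 => ⊥
  | j + 1 => shapeUpTo τ j

variable {τ}

lemma mem_shapeBelow {j : ℕ} {c : ℕ × ℕ} : c ∈ shapeBelow τ j ↔ c ∈ lam ∧ τ c.1 c.2 < j := by
  cases j with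
  | zero => simp [shapeBelow]
  | succ j =>
    rw [shapeBelow, ← YoungDiagram.mem_cells, shapeUpTo, Finset.mem_filter, YoungDiagram.mem_cells,
      Nat.lt_succ_iff]

lemma row_le_entry {i c : ℕ} (h : (i, c) ∈ lam) : i ≤ τ i c := by
  induction i with
  | zero => exact Nat.zero_le _
  | succ i ih =>
    have h1 := ih (lam.up_left_mem (Nat.le_succ i) le_rfl h)
    have h2 := τ.col_strict (Nat.lt_add_one i) h
    omega

lemma rowLen_shapeBelow_eq_zero {i j : ℕ} (h : j ≤ i) : (shapeBelow τ j).rowLen i = 0 := by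
  by_contra h0
  have := mem_shapeBelow.1 (YoungDiagram.mem_iff_lt_rowLen.2 (Nat.pos_of_ne_zero h0))
  have h1 := row_le_entry (τ := τ) this.1
  exact absurd this.2 (by dsimp only; omega)

lemma colLen_shapeBelow_le (j : ℕ) : (shapeBelow τ j).colLen 0 ≤ j := by
  by_contra h
  have h1 := YoungDiagram.mem_iff_lt_rowLen.1 (YoungDiagram.mem_iff_lt_colLen.2 (not_le.1 h))
  rw [rowLen_shapeBelow_eq_zero le_rfl] at h1
  omega

lemma isHorizontalStrip_shapeBelow {j M : ℕ} (hj : j < M) :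
    IsHorizontalStrip (shapeBelow τ j).rowLen (shapeBelow τ (j + 1)).rowLen M where
  le i := by
    refine le_of_forall_lt fun c hc => ?_
    rw [← YoungDiagram.mem_iff_lt_rowLen, mem_shapeBelow] at hc ⊢
    exact ⟨hc.1, hc.2.trans (Nat.lt_succ_self j)⟩
  succ_le i := by
    refine le_of_forall_lt fun c hc => ?_
    rw [← YoungDiagram.mem_iff_lt_rowLen, mem_shapeBelow] at hc ⊢
    refine ⟨lam.up_left_mem (Nat.le_succ i) le_rfl hc.1, ?_⟩
    have h1 := τ.col_strict (Nat.lt_add_one i) hc.1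
    have h2 := hc.2
    dsimp only at h2 ⊢
    omega
  eq_zero i hi := rowLen_shapeBelow_eq_zero (by omega)

lemma card_cells_eq_sum {kap : YoungDiagram} {M : ℕ} (hM : kap.colLen 0 ≤ M) :
    kap.cells.card = ∑ i ∈ Finset.range M, kap.rowLen i := by
  rw [Finset.card_eq_sum_card_fiberwise (f := Prod.fst) (t := Finset.range M)]
  · exact Finset.sum_congr rfl fun i _ => (kap.rowLen_eq_card).symm
  · rintro ⟨i, c⟩ hc
    have h1 : (i, c) ∈ kap := hc
    have h2 := YoungDiagram.mem_iff_lt_colLen.1 (kap.up_left_mem le_rfl (Nat.zero_le c) h1)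
    exact Finset.mem_coe.2 (Finset.mem_range.2 (by dsimp only; omega))

variable {m : ℕ} {μ : Fin m → ℕ}

lemma card_strip_shapeBelow (hτ : HasWeight τ μ) (j : Fin m) {M : ℕ} (hM : (j : ℕ) < M) :
    μ j = ∑ i ∈ Finset.range M,
      ((shapeBelow τ (j + 1)).rowLen i - (shapeBelow τ j).rowLen i) := by
  have h := isHorizontalStrip_shapeBelow (τ := τ) hM
  rw [Finset.sum_tsub_distrib _ fun i _ => h.le i,
    ← card_cells_eq_sum ((colLen_shapeBelow_le _).trans hM),
    ← card_cells_eq_sum ((colLen_shapeBelow_le _).trans hM.le), ← hτ.2 j]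
  have hdisj : (shapeBelow τ (j + 1)).cells =
      (shapeBelow τ j).cells ∪ lam.cells.filter fun c => τ c.1 c.2 = (j : ℕ) := by
    ext c
    simp only [Finset.mem_union, Finset.mem_filter, YoungDiagram.mem_cells, mem_shapeBelow,
      Nat.lt_succ_iff_lt_or_eq]
    tauto
  rw [hdisj, Finset.card_union_of_disjoint, Nat.add_sub_cancel_left]
  refine Finset.disjoint_left.2 fun c h1 h2 => ?_
  rw [YoungDiagram.mem_cells, mem_shapeBelow] at h1
  exact h1.2.ne (Finset.mem_filter.1 h2).2

lemma shapeBelow_eq (hτ : HasWeight τ μ) : shapeBelow τ m = lam := by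
  ext c
  rw [YoungDiagram.mem_cells, YoungDiagram.mem_cells, mem_shapeBelow]
  exact and_iff_left_of_imp fun h => hτ.1 c h

end Tableau

/-! ### Top left blocks of matrices in the slice -/

section Blocks

variable {m : ℕ} {μ : Fin m → ℕ}

/-- The boxes in the first `j` blocks. -/
abbrev BoxBelow (μ : Fin m → ℕ) (j : ℕ) : Type := {p : Box μ // (p.1 : ℕ) < j}

/-- The top left submatrix formed by the first `j` blocks. -/
def block (x : Aff (Box μ × Box μ)) (j : ℕ) : Matrix (BoxBelow μ j) (BoxBelow μ j) ℂ :=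
  Matrix.of fun p q => x (p.1, q.1)

/-- The positions of the free entries of a strictly upper-triangular matrix in the slice. -/
def IsFree (p q : Box μ) : Prop := p.1 < q.1 ∧ (p.2 : ℕ) + 1 = μ p.1

/-- Outside the free positions, the first `j` blocks of columns are those of the Jordan matrix. -/
def HasSliceShape (x : Aff (Box μ × Box μ)) (j : ℕ) : Prop :=
  ∀ p q : Box μ, (q.1 : ℕ) < j → ¬ IsFree p q → x (p, q) = jordan μ p q

/-- The extension by zero of a vector supported on the first `j` blocks. -/
def inclBelow (μ : Fin m → ℕ) (j : ℕ) : (BoxBelow μ j → ℂ) →ₗ[ℂ] (BoxBelow μ (j + 1) → ℂ) where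
  toFun v p := if h : (p.1.1 : ℕ) < j then v ⟨p.1, h⟩ else 0
  map_add' v w := by ext p; by_cases h : (p.1.1 : ℕ) < j <;> simp [h]
  map_smul' c v := by ext p; by_cases h : (p.1.1 : ℕ) < j <;> simp [h]

variable (x : Aff (Box μ × Box μ)) (j : Fin m)

/-- The part above the diagonal block of the column `t` of the `j`-th block of columns. -/
def newCol (t : ℕ) : BoxBelow μ j → ℂ := fun p => if h : t < μ j then x (p.1, ⟨j, t, h⟩) else 0

/-- The vector of the subspace spanned by the first `j` blocks that defines the next subspace as an
extension. -/
def extVec : BoxBelow μ j → ℂ := ∑ t ∈ Finset.range (μ j), block x j ^ t *ᵥ newCol x j t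

/-- The basis vector of the `j`-th block that is `s` steps before the last one, and zero if there
is no such vector. -/
def fromTop (μ : Fin m → ℕ) (j : Fin m) (s : ℕ) : BoxBelow μ (j + 1) → ℂ :=
  fun p => if p.1.1 = j ∧ (p.1.2 : ℕ) + s + 1 = μ j then 1 else 0

variable {x j}

lemma inclBelow_of_lt {j : ℕ} (v : BoxBelow μ j → ℂ) {p : BoxBelow μ (j + 1)}
    (h : (p.1.1 : ℕ) < j) : inclBelow μ j v p = v ⟨p.1, h⟩ := dif_pos h

lemma inclBelow_of_not_lt {j : ℕ} (v : BoxBelow μ j → ℂ) {p : BoxBelow μ (j + 1)}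
    (h : ¬ (p.1.1 : ℕ) < j) : inclBelow μ j v p = 0 := dif_neg h

lemma inclBelow_injective (μ : Fin m → ℕ) (j : ℕ) : Function.Injective (inclBelow μ j) := by
  intro v w h
  ext p
  have := congrFun h ⟨p.1, p.2.trans (Nat.lt_succ_self j)⟩
  simpa [inclBelow, p.2] using this

lemma block_mulVec_inclBelow (hx : HasSliceShape x (j + 1)) (v : BoxBelow μ j → ℂ) :
    block x (j + 1) *ᵥ inclBelow μ j v = inclBelow μ j (block x j *ᵥ v) := by
  have hsum : ∀ p, (block x (j + 1) *ᵥ inclBelow μ j v) p =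
      ∑ q : BoxBelow μ j, x (p.1, q.1) * v q := by
    intro p
    let f : BoxBelow μ j → BoxBelow μ (j + 1) := fun q => ⟨q.1, q.2.trans (Nat.lt_succ_self _)⟩
    have hf : Function.Injective f := fun a b h => Subtype.ext (congrArg (fun z => z.1) h)
    rw [Matrix.mulVec, dotProduct]
    refine (Finset.sum_of_injOn f hf.injOn (fun _ _ => Finset.mem_univ _) ?_ ?_).symm
    · intro q _ hq
      have hq' : ¬ (q.1.1 : ℕ) < j := fun h => hq ⟨⟨q.1, h⟩, by simp, rfl⟩
      rw [inclBelow_of_not_lt v hq', mul_zero]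
    · intro q _
      rw [inclBelow_of_lt v (p := f q) q.2]
      rfl
  ext p
  rw [hsum]
  by_cases hp : (p.1.1 : ℕ) < j
  · rw [inclBelow_of_lt _ hp]
    rfl
  · rw [inclBelow_of_not_lt _ hp]
    refine Finset.sum_eq_zero fun q _ => ?_
    have hq := q.2
    rw [hx p.1 q.1 (hq.trans (Nat.lt_succ_self _)) (fun h => hp (lt_trans h.1 hq)), jordan, if_neg,
      zero_mul]
    rintro ⟨h, -⟩
    rw [h] at hp
    exact hp hq

lemma block_mulVec_fromTop (hx : HasSliceShape x (j + 1)) {s : ℕ} (hs : s < μ j) :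
    block x (j + 1) *ᵥ fromTop μ j s =
      fromTop μ j (s + 1) + inclBelow μ j (newCol x j (μ j - (s + 1))) := by
  let q₀ : BoxBelow μ (j + 1) := ⟨⟨j, μ j - (s + 1), by omega⟩, Nat.lt_succ_self _⟩
  have h1 : fromTop μ j s = Pi.single q₀ 1 := by
    ext ⟨⟨i, a⟩, hp⟩
    rw [fromTop, Pi.single_apply]
    refine if_congr ?_ rfl rfl
    constructor
    · rintro ⟨h1, h2⟩
      dsimp only at h1 h2
      subst h1
      refine Subtype.ext (Sigma.ext rfl (heq_of_eq (Fin.ext ?_)))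
      change (a : ℕ) = μ i - (s + 1)
      omega
    · intro h
      have h2 : (⟨i, a⟩ : Box μ) = ⟨j, μ j - (s + 1), by omega⟩ := congrArg Subtype.val h
      obtain ⟨h3, h4⟩ := Sigma.mk.inj_iff.1 h2
      subst h3
      rw [eq_of_heq h4]
      exact ⟨rfl, by change μ i - (s + 1) + s + 1 = μ i; omega⟩
  rw [h1, Matrix.mulVec_single_one]
  ext ⟨p, hp⟩
  change x (p, q₀.1) = (if p.1 = j ∧ (p.2 : ℕ) + (s + 1) + 1 = μ j then 1 else 0) +
    if h : (p.1 : ℕ) < j then newCol x j (μ j - (s + 1)) ⟨p, h⟩ else 0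
  by_cases h : (p.1 : ℕ) < j
  · have hne : p.1 ≠ j := fun h' => by rw [h'] at h; exact lt_irrefl _ h
    rw [dif_pos h, if_neg fun h' => hne h'.1, zero_add, newCol, dif_pos (by omega)]
  · have hpj : p.1 = j := Fin.ext (by omega)
    rw [dif_neg h, add_zero, hx p q₀.1 (Nat.lt_succ_self _) (fun hf => h hf.1), jordan]
    refine if_congr (and_congr Iff.rfl ?_) rfl rfl
    change (p.2 : ℕ) + 1 = μ j - (s + 1) ↔ _
    omega

lemma block_pow_fromTop (hx : HasSliceShape x (j + 1)) {s : ℕ} (hs : s ≤ μ j) :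
    (Matrix.toLin' (block x (j + 1)) ^ s) (fromTop μ j 0) = fromTop μ j s +
      inclBelow μ j (∑ i ∈ Finset.range s, block x j ^ i *ᵥ newCol x j (μ j - s + i)) := by
  induction s with
  | zero => simp
  | succ s ih =>
    rw [pow_succ', Module.End.mul_apply, ih (by omega), Matrix.toLin'_apply, Matrix.mulVec_add,
      block_mulVec_inclBelow hx, block_mulVec_fromTop hx (by omega), add_assoc, ← map_add,
      Finset.sum_range_succ', Matrix.mulVec_sum, add_comm (newCol _ _ _)]
    congr 3
    · refine Finset.sum_congr rfl fun i hi => ?_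
      rw [Matrix.mulVec_mulVec, ← pow_succ']
      congr 2
      omega
    · simp

/-- The operator on the first `j + 1` blocks is a cyclic extension of that on the first `j`
blocks, generated by the last basis vector of the `j`-th block. Applying the operator to a basis
vector of this block gives the previous one and the part of its column above the diagonal block;
after `μ j` steps only the images of these parts are left. -/
theorem isCyclicExtension_block (hx : HasSliceShape x (j + 1)) (hnil : IsNilpotent (block x j)) :
    IsCyclicExtension (inclBelow μ j) (Matrix.toLin' (block x j))
      (Matrix.toLin' (block x (j + 1))) (fromTop μ j 0) (μ j) (extVec x j) where
  injective := inclBelow_injective μ j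
  comm := LinearMap.ext fun v => block_mulVec_inclBelow hx v
  nilpotent := by
    obtain ⟨K, hK⟩ := hnil
    exact ⟨K, by rw [← Matrix.toLin'_pow, hK, map_zero]⟩
  span := by
    set S := LinearMap.range (inclBelow μ j) ⊔
      cyclicSpan (Matrix.toLin' (block x (j + 1))) (fromTop μ j 0)
    have hι : ∀ v, inclBelow μ j v ∈ S := fun v =>
      (le_sup_left : LinearMap.range (inclBelow μ j) ≤ S) ⟨v, rfl⟩
    have htop : ∀ s ≤ μ j, fromTop μ j s ∈ S := fun s hs => by
      have h1 : (Matrix.toLin' (block x (j + 1)) ^ s) (fromTop μ j 0) ∈ S :=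
        (le_sup_right : cyclicSpan _ _ ≤ S) (pow_mem_cyclicSpan _ _ s)
      rw [block_pow_fromTop hx hs] at h1
      exact (Submodule.add_mem_iff_left S (hι _)).1 h1
    rw [eq_top_iff]
    intro v _
    have hv : v = inclBelow μ j (fun p => v ⟨p.1, p.2.trans (Nat.lt_succ_self _)⟩) +
        ∑ a : Fin (μ j), v ⟨⟨j, a⟩, Nat.lt_succ_self _⟩ • fromTop μ j (μ j - 1 - a) := by
      ext ⟨⟨i, a⟩, hp⟩
      rw [Pi.add_apply, Finset.sum_apply]
      by_cases h : (i : ℕ) < j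
      · have hne : i ≠ j := fun h' => by rw [h'] at h; exact lt_irrefl _ h
        rw [inclBelow_of_lt _ h]
        simp [fromTop, hne]
      · have hij : i = j := Fin.ext (by dsimp only at hp; omega)
        subst hij
        rw [Finset.sum_eq_single a]
        · have ha := a.2
          have h2 : (a : ℕ) + (μ i - 1 - a) + 1 = μ i := by omega
          simp [inclBelow, fromTop, h2]
        · intro b _ hb
          have hb' : ¬ ((a : ℕ) + (μ i - 1 - b) + 1 = μ i) := fun h3 =>
            hb (Fin.ext (by have := a.2; have := b.2; omega))
          simp [fromTop, hb']
        · simp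
    rw [hv]
    exact S.add_mem (hι _) (S.sum_mem fun a _ => S.smul_mem _ (htop _ (by omega)))
  pow_eq := by
    rw [block_pow_fromTop hx le_rfl]
    have h0 : fromTop μ j (μ j) = 0 := by
      ext p
      exact if_neg fun h => by omega
    simp [h0, extVec]
  pow_notMem i hi := by
    rw [block_pow_fromTop hx hi.le]
    rintro ⟨v, hv⟩
    have h1 := congrFun hv ⟨⟨j, μ j - 1 - i, by omega⟩, Nat.lt_succ_self _⟩
    have h2 : μ j - 1 - i + i + 1 = μ j := by omega
    simp [inclBelow, fromTop, h2] at h1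

end Blocks

/-! ### The free entries of a block of columns -/

section Fill

variable {m : ℕ} {μ : Fin m → ℕ}

/-- The index set of the parameters added by the `j`-th block: a pair of a block `i < j`, with the
last row of which the parameter is in, and a column in the `j`-th block. -/
abbrev FreeIndex (μ : Fin m → ℕ) (j : Fin m) : Type :=
  {i : Fin m // i < j} × {q : Box μ // q.1 = j}

lemma card_freeIndex (μ : Fin m → ℕ) (j : Fin m) : Fintype.card (FreeIndex μ j) = j * μ j := by
  let f : Fin (μ j) → {q : Box μ // q.1 = j} := fun a => ⟨⟨j, a⟩, rfl⟩
  have hf : Function.Bijective f := by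
    refine ⟨fun a a' h => ?_, ?_⟩
    · exact eq_of_heq (Sigma.mk.inj_iff.1 (congrArg Subtype.val h)).2
    · rintro ⟨⟨i, a⟩, h⟩
      dsimp only at h
      subst h
      exact ⟨a, rfl⟩
  have h1 : Fintype.card {i : Fin m // i < j} = j := by
    rw [Fintype.card_subtype, ← Fin.card_Iio]
    congr 1
    ext i
    simp
  rw [Fintype.card_prod, ← Fintype.card_of_bijective hf, h1, Fintype.card_fin]

/-- The matrix obtained by setting the blocks of columns from the `j`-th one on to zero. -/
def truncate (j : ℕ) (x : Aff (Box μ × Box μ)) : Aff (Box μ × Box μ) :=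
  ⟨fun e => if (e.2.1 : ℕ) < j then x e else 0⟩

/-- The matrix with the `j`-th block of columns replaced by that of a matrix in the slice with the
given parameters. -/
def fill (j : Fin m) (x : Aff (Box μ × Box μ)) (v : FreeIndex μ j → ℂ) : Aff (Box μ × Box μ) :=
  ⟨fun e => if hq : e.2.1 = j then
    if hp : e.1.1 < j ∧ (e.1.2 : ℕ) + 1 = μ e.1.1 then v (⟨e.1.1, hp.1⟩, ⟨e.2, hq⟩)
    else jordan μ e.1 e.2 else x e⟩

/-- The parameters in the `j`-th block of columns. -/
def param (j : Fin m) (x : Aff (Box μ × Box μ)) : Aff (FreeIndex μ j) :=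
  ⟨fun b => ∑ p : Box μ, if p.1 = b.1 ∧ (p.2 : ℕ) + 1 = μ p.1 then x (p, b.2) else 0⟩

/-- The matrix that computes a new column from the parameters. -/
def colMat (μ : Fin m → ℕ) (j : Fin m) (t : ℕ) : Matrix (BoxBelow μ j) (FreeIndex μ j) ℂ :=
  Matrix.of fun p b =>
    if p.1.1 = b.1 ∧ (p.1.2 : ℕ) + 1 = μ p.1.1 ∧ (b.2.1.2 : ℕ) = t then 1 else 0

/-- The matrix that computes the vector defining the extension from the parameters. -/
def extMat (j : Fin m) (x : Aff (Box μ × Box μ)) : Matrix (BoxBelow μ j) (FreeIndex μ j) ℂ :=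
  ∑ t ∈ Finset.range (μ j), block x j ^ t * colMat μ j t

variable {j : Fin m} {x y : Aff (Box μ × Box μ)} {v : FreeIndex μ j → ℂ}

lemma last_unique {p p' : Box μ} (h : p.1 = p'.1) (hp : (p.2 : ℕ) + 1 = μ p.1)
    (hp' : (p'.2 : ℕ) + 1 = μ p'.1) : p = p' := by
  obtain ⟨i, a⟩ := p
  obtain ⟨i', a'⟩ := p'
  dsimp only at h
  subst h
  exact Sigma.ext rfl (heq_of_eq (Fin.ext (Nat.succ_injective (hp.trans hp'.symm))))

lemma param_apply {p : Box μ} (hp : p.1 < j ∧ (p.2 : ℕ) + 1 = μ p.1) {q : Box μ} (hq : q.1 = j) :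
    param j x (⟨p.1, hp.1⟩, ⟨q, hq⟩) = x (p, q) := by
  change ∑ p' : Box μ, _ = _
  rw [Finset.sum_eq_single p]
  · exact if_pos ⟨rfl, hp.2⟩
  · rintro p' - hne
    exact if_neg fun h => hne (last_unique h.1 h.2 hp.2)
  · simp

lemma fill_free {p q : Box μ} (hp : p.1 < j ∧ (p.2 : ℕ) + 1 = μ p.1) (hq : q.1 = j) :
    fill j x v (p, q) = v (⟨p.1, hp.1⟩, ⟨q, hq⟩) := by
  simp only [fill, dif_pos hq, dif_pos hp]

lemma fill_notFree {p q : Box μ} (hp : ¬ (p.1 < j ∧ (p.2 : ℕ) + 1 = μ p.1)) (hq : q.1 = j) :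
    fill j x v (p, q) = jordan μ p q := by
  simp only [fill, dif_pos hq, dif_neg hp]

lemma fill_of_ne {p q : Box μ} (hq : q.1 ≠ j) : fill j x v (p, q) = x (p, q) := by
  simp only [fill, dif_neg hq]

/-- Every block above the `j`-th one has a last row if the `j`-th block is not empty, because the
sizes of the blocks decrease. -/
lemma exists_last (hμ : Antitone μ) (b : FreeIndex μ j) :
    ∃ p : Box μ, p.1 = b.1 ∧ (p.2 : ℕ) + 1 = μ p.1 := by
  have h1 : 0 < μ j := by
    obtain ⟨q, hq⟩ := b.2
    rw [← hq]
    exact q.2.pos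
  have h2 := hμ b.1.2.le
  exact ⟨⟨b.1, μ b.1 - 1, by omega⟩, rfl, by dsimp only; omega⟩

lemma param_fill (hμ : Antitone μ) : (param j (fill j x v)).toFun = v := by
  ext b
  obtain ⟨p, hp, hp'⟩ := exists_last hμ b
  have hlt : p.1 < j := hp ▸ b.1.2
  have hb : b = (⟨p.1, hlt⟩, ⟨b.2.1, b.2.2⟩) := Prod.ext (Subtype.ext hp.symm) rfl
  rw [hb, param_apply ⟨hlt, hp'⟩, fill_free ⟨hlt, hp'⟩ b.2.2]

lemma fill_truncate_param (hx : HasSliceShape y (j + 1))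
    (h0 : ∀ p q : Box μ, (j : ℕ) + 1 ≤ q.1 → y (p, q) = 0) :
    fill j (truncate j y) (param j y).toFun = y := by
  ext ⟨p, q⟩
  by_cases hq : q.1 = j
  · by_cases hp : p.1 < j ∧ (p.2 : ℕ) + 1 = μ p.1
    · rw [fill_free hp hq, param_apply hp hq]
    · rw [fill_notFree hp hq, hx p q (by rw [hq]; exact Nat.lt_succ_self _)]
      rintro ⟨h1, h2⟩
      exact hp ⟨hq ▸ h1, h2⟩
  · rw [fill_of_ne hq]
    change (if (q.1 : ℕ) < j then y (p, q) else 0) = _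
    split_ifs with h
    · rfl
    · have : (q.1 : ℕ) ≠ j := fun h' => hq (Fin.ext h')
      exact (h0 p q (by omega)).symm

lemma truncate_fill (h0 : ∀ p q : Box μ, (j : ℕ) ≤ q.1 → x (p, q) = 0) :
    truncate j (fill j x v) = x := by
  ext ⟨p, q⟩
  change (if (q.1 : ℕ) < j then fill j x v (p, q) else 0) = _
  split_ifs with h
  · exact fill_of_ne fun h' => by rw [h'] at h; exact lt_irrefl _ h
  · exact (h0 p q (not_lt.1 h)).symm

lemma hasSliceShape_fill (hx : HasSliceShape x j) : HasSliceShape (fill j x v) (j + 1) := by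
  intro p q hq hf
  by_cases hqj : q.1 = j
  · exact fill_notFree (fun h => hf ⟨hqj ▸ h.1, h.2⟩) hqj
  · rw [fill_of_ne hqj]
    have : (q.1 : ℕ) ≠ j := fun h' => hqj (Fin.ext h')
    exact hx p q (by omega) hf

lemma block_fill {i : ℕ} (hi : i ≤ j) : block (fill j x v) i = block x i := by
  ext p q
  refine fill_of_ne fun h => ?_
  have h1 := q.2
  rw [h] at h1
  omega

lemma block_truncate {i : ℕ} (hi : i ≤ j) : block (truncate j x) i = block x i := by
  ext p q
  exact if_pos (q.2.trans_le hi)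

lemma hasSliceShape_truncate (hx : HasSliceShape x (j + 1)) : HasSliceShape (truncate j x) j := by
  intro p q hq hf
  change (if (q.1 : ℕ) < j then x (p, q) else 0) = _
  rw [if_pos hq, hx p q (by omega) hf]

lemma colMat_mulVec {t : ℕ} (ht : t < μ j) (p : BoxBelow μ j) :
    (colMat μ j t *ᵥ v) p = if (p.1.2 : ℕ) + 1 = μ p.1.1 then
      v (⟨p.1.1, p.2⟩, ⟨⟨j, t, ht⟩, rfl⟩) else 0 := by
  rw [Matrix.mulVec, dotProduct, Finset.sum_eq_single (⟨p.1.1, p.2⟩, ⟨⟨j, t, ht⟩, rfl⟩)]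
  · simp [colMat]
  · rintro ⟨⟨i, hi⟩, ⟨⟨j', a⟩, hq⟩⟩ - hne
    dsimp only at hq
    subst hq
    rw [colMat, Matrix.of_apply, if_neg, zero_mul]
    rintro ⟨h1, -, h2⟩
    refine hne (Prod.ext (Subtype.ext h1.symm) (Subtype.ext (Sigma.ext rfl (heq_of_eq ?_))))
    exact Fin.ext h2
  · simp

lemma newCol_fill {t : ℕ} (ht : t < μ j) : newCol (fill j x v) j t = colMat μ j t *ᵥ v := by
  ext p
  rw [colMat_mulVec ht, newCol, dif_pos ht]
  split_ifs with hp
  · exact fill_free ⟨p.2, hp⟩ rfl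
  · rw [fill_notFree (q := ⟨j, t, ht⟩) (fun h => hp h.2) rfl, jordan, if_neg]
    rintro ⟨h, -⟩
    exact absurd p.2 (by rw [h]; exact lt_irrefl _)

lemma extVec_fill : extVec (fill j x v) j = extMat j x *ᵥ v := by
  rw [extVec, extMat, Matrix.sum_mulVec, block_fill le_rfl]
  refine Finset.sum_congr rfl fun t ht => ?_
  rw [newCol_fill (Finset.mem_range.1 ht), Matrix.mulVec_mulVec]

/-- Modulo the last rows of the blocks, every vector is in the range. -/
lemma exists_sub_mulVec_eq_zero (hx : HasSliceShape x j) (y : BoxBelow μ j → ℂ) :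
    ∃ y' : BoxBelow μ j → ℂ, ∀ p : BoxBelow μ j, (p.1.2 : ℕ) + 1 ≠ μ p.1.1 →
      (y - block x j *ᵥ y') p = 0 := by
  refine ⟨fun p => if 0 < (p.1.2 : ℕ) then y ⟨⟨p.1.1, p.1.2 - 1, by omega⟩, p.2⟩ else 0, ?_⟩
  rintro ⟨⟨i, a⟩, hp⟩ hlast
  have ha : (a : ℕ) + 1 < μ i := by have := a.2; dsimp only at hlast; omega
  rw [Pi.sub_apply, sub_eq_zero, Matrix.mulVec, dotProduct,
    Finset.sum_eq_single ⟨⟨i, a + 1, ha⟩, hp⟩]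
  · have h1 : block x j ⟨⟨i, a⟩, hp⟩ ⟨⟨i, a + 1, ha⟩, hp⟩ = 1 := by
      refine (hx ⟨i, a⟩ ⟨i, a + 1, ha⟩ hp fun h => hlast h.2).trans ?_
      exact if_pos ⟨rfl, rfl⟩
    rw [h1]
    simp
  · rintro ⟨⟨i', a'⟩, hp'⟩ - hne
    have h1 : block x j ⟨⟨i, a⟩, hp⟩ ⟨⟨i', a'⟩, hp'⟩ = 0 := by
      refine (hx ⟨i, a⟩ ⟨i', a'⟩ hp' fun h => hlast h.2).trans (if_neg ?_)
      rintro ⟨h2, h3⟩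
      dsimp only at h2 h3
      subst h2
      exact hne (Subtype.ext (Sigma.ext rfl (heq_of_eq (Fin.ext h3.symm))))
    rw [h1, zero_mul]
  · simp

/-- The vectors that define extensions fill the whole space modulo the range of the `μ j`-th
power. -/
lemma exists_extMat_mulVec (hμ : Antitone μ) (hx : HasSliceShape x j) (z : BoxBelow μ j → ℂ) :
    ∃ (v : FreeIndex μ j → ℂ) (z' : BoxBelow μ j → ℂ),
      z = extMat j x *ᵥ v + block x j ^ μ j *ᵥ z' := by
  choose next hnext using exists_sub_mulVec_eq_zero hx
  let s : ℕ → BoxBelow μ j → ℂ := fun t => next^[t] z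
  have hs : ∀ t, s (t + 1) = next (s t) := fun t => Function.iterate_succ_apply' _ _ _
  let r : ℕ → BoxBelow μ j → ℂ := fun t => s t - block x j *ᵥ s (t + 1)
  have hsum : ∀ n, z = ∑ t ∈ Finset.range n, block x j ^ t *ᵥ r t + block x j ^ n *ᵥ s n := by
    intro n
    induction n with
    | zero => simp [s]
    | succ n ih =>
      rw [Finset.sum_range_succ, pow_succ, ← Matrix.mulVec_mulVec, add_assoc, ← Matrix.mulVec_add]
      simpa [r] using ih
  choose last hlast hlast' using exists_last (j := j) hμ
  let v : FreeIndex μ j → ℂ := fun b => r b.2.1.2 ⟨last b, by rw [hlast]; exact b.1.2⟩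
  refine ⟨v, s (μ j), ?_⟩
  rw [extMat, Matrix.sum_mulVec]
  conv_lhs => rw [hsum (μ j)]
  congr 1
  refine Finset.sum_congr rfl fun t ht => ?_
  rw [← Matrix.mulVec_mulVec]
  congr 1
  ext p
  rw [colMat_mulVec (Finset.mem_range.1 ht)]
  split_ifs with hp
  · change r t p = r t _
    congr 1
    exact Subtype.ext (last_unique (hlast (⟨p.1.1, p.2⟩, ⟨⟨j, t, _⟩, rfl⟩)).symm hp (hlast' _))
  · change (s t - block x j *ᵥ s (t + 1)) p = 0
    rw [hs]
    exact hnext _ p hp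

end Fill

/-! ### The tower of varieties -/

section Stage

variable {m : ℕ} {μ : Fin m → ℕ} {lam : YoungDiagram}

/-- The variety of the part of a tableau with letters `< j`, embedded in the space of matrices on
all blocks by setting the remaining columns to zero. -/
def stage (τ : SemistandardYoungTableau lam) (μ : Fin m → ℕ) (j : ℕ) : Set (Aff (Box μ × Box μ)) :=
  {x | (∀ p q : Box μ, j ≤ q.1 → x (p, q) = 0) ∧ HasSliceShape x j ∧
    ∀ i ≤ j, block x i ∈ orbit (BoxBelow μ i) (shapeBelow τ i)}

/-- The coordinates that vanish for vectors satisfying `IsGood`. -/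
abbrev ForcedZero (kap lam : YoungDiagram) (M : ℕ) : Type :=
  {p : Box (rows kap) //
    rows kap p.1 ≤ p.2 + stripBefore kap.rowLen lam.rowLen M (rows kap p.1)}

lemma card_forcedZero {kap lam : YoungDiagram} {M : ℕ}
    (h : IsHorizontalStrip kap.rowLen lam.rowLen M) (hM : kap.colLen 0 ≤ M) :
    Fintype.card (ForcedZero kap lam M) =
      ∑ i ∈ Finset.range M, i * (lam.rowLen i - kap.rowLen i) := by
  have hcount : ∀ n d : ℕ, d ≤ n → ∑ a : Fin n, (if n ≤ (a : ℕ) + d then 1 else 0) = d := by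
    intro n d hd
    rw [Fin.sum_univ_eq_sum_range fun a => if n ≤ a + d then 1 else 0, ← Finset.card_filter]
    have : (Finset.range n).filter (fun a => n ≤ a + d) = Finset.Ico (n - d) n := by
      ext a
      simp only [Finset.mem_filter, Finset.mem_range, Finset.mem_Ico]
      omega
    rw [this, Nat.card_Ico]
    omega
  rw [Fintype.card_subtype, Finset.card_filter, Fintype.sum_sigma, ← h.sum_stripBefore_a,
    ← sum_rows hM (f := stripBefore kap.rowLen lam.rowLen M) (Nat.le_zero.1 (h.stripBefore_le 0))]
  exact Finset.sum_congr rfl fun i _ => hcount _ _ (h.stripBefore_le _)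

variable {τ : SemistandardYoungTableau lam} {j : Fin m} {x : Aff (Box μ × Box μ)}
  {P : Matrix (BoxBelow μ j) (Box (rows (shapeBelow τ j))) ℂ}
  {Q : Matrix (Box (rows (shapeBelow τ j))) (BoxBelow μ j) ℂ}

lemma isStripExtension_fill (hτ : HasWeight τ μ) (hx : x ∈ stage τ μ j) (hPQ : P * Q = 1)
    (hQP : Q * P = 1) (hA : block x j * P = P * jordan (rows (shapeBelow τ j)))
    (v : FreeIndex μ j → ℂ) :
    IsStripExtension (shapeBelow τ j) (shapeBelow τ (j + 1)) m (μ j) (block x j)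
      (block (fill j x v) (j + 1)) P Q (inclBelow μ j) (fromTop μ j 0)
      (Q *ᵥ (extMat j x *ᵥ v)) where
  strip := isHorizontalStrip_shapeBelow j.2
  colLen_kap := (colLen_shapeBelow_le _).trans j.2.le
  colLen_lam := (colLen_shapeBelow_le _).trans j.2
  card_strip := card_strip_shapeBelow hτ j j.2
  mul_inv := hPQ
  inv_mul := hQP
  conj := hA
  rank := mem_orbit_iff.1 (hx.2.2 j le_rfl)
  ext := by
    have h := isCyclicExtension_block (hasSliceShape_fill (v := v) hx.2.1)
      (by rw [block_fill le_rfl]; exact isNilpotent_of_rank (mem_orbit_iff.1 (hx.2.2 j le_rfl)))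
    rwa [block_fill le_rfl, extVec_fill, ← Matrix.one_mulVec (extMat j x *ᵥ v), ← hPQ,
      ← Matrix.mulVec_mulVec] at h

/-- The condition for a point to be in the fibre over `x` splits into linear equations and an open
condition. -/
lemma fill_mem_stage_iff (hτ : HasWeight τ μ) (hx : x ∈ stage τ μ j) (hPQ : P * Q = 1)
    (hQP : Q * P = 1) (hA : block x j * P = P * jordan (rows (shapeBelow τ j)))
    (v : FreeIndex μ j → ℂ) :
    fill j x v ∈ stage τ μ (j + 1) ↔ IsGood (shapeBelow τ (j + 1)) m (Q *ᵥ (extMat j x *ᵥ v)) ∧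
      ∀ r, colTail (shapeBelow τ (j + 1)) r ≤ (block (fill j x v) (j + 1) ^ r).rank := by
  rw [← (isStripExtension_fill hτ hx hPQ hQP hA v).rank_le_colTail_iff, ← forall_and]
  have hle : fill j x v ∈ stage τ μ (j + 1) ↔
      block (fill j x v) (j + 1) ∈ orbit (BoxBelow μ (j + 1)) (shapeBelow τ (j + 1)) := by
    refine ⟨fun h => h.2.2 _ le_rfl, fun h => ⟨fun p q hq => ?_, hasSliceShape_fill hx.2.1,
      fun i hi => ?_⟩⟩
    · rw [fill_of_ne fun h' => by rw [h'] at hq; omega, hx.1 p q (by omega)]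
    · rcases Nat.lt_succ_iff_lt_or_eq.1 (Nat.lt_succ_of_le hi) with hi | rfl
      · rw [block_fill (by omega)]
        exact hx.2.2 i (by omega)
      · exact h
  rw [hle, mem_orbit_iff]
  exact forall_congr' fun r => ⟨fun h => ⟨h.le, h.ge⟩, fun h => le_antisymm h.1 h.2⟩

/-- The coordinates of the vector defining the extension that are forced to vanish can be prescribed
arbitrarily, as can those among the last `μ j` ones in each block. -/
lemma exists_coordinates_eq (hμ : Antitone μ) (hx : HasSliceShape x j) (hPQ : P * Q = 1)
    (hQP : Q * P = 1) (hA : block x j * P = P * jordan (rows (shapeBelow τ j)))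
    (z : Box (rows (shapeBelow τ j)) → ℂ) :
    ∃ v, ∀ p : Box (rows (shapeBelow τ j)), rows (shapeBelow τ j) p.1 ≤ p.2 + μ j →
      (Q *ᵥ (extMat j x *ᵥ v)) p = z p := by
  obtain ⟨v, y, hv⟩ := exists_extMat_mulVec hμ hx (P *ᵥ z)
  refine ⟨v, fun p hp => ?_⟩
  have h1 : Q * block x j = jordan (rows (shapeBelow τ j)) * Q := by
    calc Q * block x j = Q * (block x j * P) * Q := by
          rw [Matrix.mul_assoc, Matrix.mul_assoc, hPQ, Matrix.mul_one]
      _ = _ := by rw [hA, ← Matrix.mul_assoc, hQP, Matrix.one_mul]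
  have h2 : ∀ r, Q * block x j ^ r = jordan (rows (shapeBelow τ j)) ^ r * Q := by
    intro r
    induction r with
    | zero => simp
    | succ r ih =>
      rw [pow_succ, ← Matrix.mul_assoc, ih, Matrix.mul_assoc, h1, ← Matrix.mul_assoc, ← pow_succ]
  have h3 := congrArg (Q *ᵥ ·) hv
  simp only [Matrix.mulVec_add] at h3
  rw [Matrix.mulVec_mulVec, hQP, Matrix.one_mulVec, Matrix.mulVec_mulVec _ Q (block x j ^ μ j), h2,
    ← Matrix.mulVec_mulVec] at h3
  rw [h3, Pi.add_apply, jordan_pow_mulVec, extend_of_le _ hp, add_zero]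

end Stage

section Step

variable {m : ℕ} {μ : Fin m → ℕ} {lam : YoungDiagram} {τ : SemistandardYoungTableau lam}
  {j : Fin m}

lemma regularMatOn_block {S : Set (Aff (Box μ × Box μ))} (i : ℕ) :
    RegularMatOn S fun x => block x i :=
  fun p q => .coord (p.1, q.1)

lemma regularMatOn_extMat {S : Set (Aff (Box μ × Box μ))} : RegularMatOn S (extMat j) := by
  intro p b
  refine (RegularOn.sum (Finset.range (μ j)) fun t _ =>
    ((regularMatOn_block _).pow t).mul (RegularMatOn.const (colMat μ j t)) p b).congr fun x _ => ?_
  rw [extMat, Matrix.sum_apply]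

lemma regularMapOn_truncate {S : Set (Aff (Box μ × Box μ))} (j : ℕ) :
    RegularMapOn S (truncate j) := by
  intro b
  simp only [truncate]
  split_ifs
  exacts [.coord b, .const 0]

lemma regularMapOn_param {S : Set (Aff (Box μ × Box μ))} : RegularMapOn S (param j) := by
  intro b
  refine .sum _ fun p _ => ?_
  split_ifs
  exacts [.coord _, .const 0]

lemma RegularMapOn.fill {σ : Type} {S : Set (Aff σ)} {F : Aff σ → Aff (Box μ × Box μ)}
    {G : Aff σ → Aff (FreeIndex μ j)} (hF : RegularMapOn S F) (hG : RegularMapOn S G) :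
    RegularMapOn S fun z => fill j (F z) (G z).toFun := by
  intro b
  simp only [MVSlice.fill]
  split_ifs
  exacts [hG _, .const _, hF _]

lemma RegularMapOn.mulVec {σ b c : Type} [Fintype b] {S : Set (Aff σ)}
    {M : Aff σ → Matrix c b ℂ} {G : Aff σ → Aff b} (hM : RegularMatOn S M)
    (hG : RegularMapOn S G) : RegularMapOn S fun z => ⟨M z *ᵥ (G z).toFun⟩ :=
  fun i => .sum _ fun k _ => (hM i k).mul (hG k)

/-- Locally on the variety, the top left block is put into Jordan normal form by a regular family of
matrices. -/
lemma exists_regular_jordan_conj {x₀ : Aff (Box μ × Box μ)} (hx₀ : x₀ ∈ stage τ μ j) :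
    ∃ (U : Set (Aff (Box μ × Box μ)))
      (P : Aff (Box μ × Box μ) → Matrix (BoxBelow μ j) (Box (rows (shapeBelow τ j))) ℂ)
      (Q : Aff (Box μ × Box μ) → Matrix (Box (rows (shapeBelow τ j))) (BoxBelow μ j) ℂ),
      IsOpen U ∧ x₀ ∈ U ∧ RegularMatOn (stage τ μ j ∩ U) Q ∧ ∀ x ∈ stage τ μ j ∩ U,
        P x * Q x = 1 ∧ Q x * P x = 1 ∧
          block x j * P x = P x * jordan (rows (shapeBelow τ j)) := by
  have hcard : Fintype.card (Box (rows (shapeBelow τ j))) = Fintype.card (BoxBelow μ j) := by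
    rw [card_box_rows, ← mem_orbit_iff.1 (hx₀.2.2 j le_rfl) 0, pow_zero, Matrix.rank_one]
  let e := Fintype.equivOfCardEq hcard
  obtain ⟨U, g, h, hU, hxU, -, hh, hgh⟩ := exists_regular_conjugation (X := stage τ μ j)
    (A := fun x => block x j) (regularMatOn_block j)
    (fun x hx => exists_conj_of_rank (mem_orbit_iff.1 (hx.2.2 j le_rfl)) e) hx₀
  refine ⟨U, fun x => (g x).submatrix id e, fun x => (h x).submatrix e id, hU, hxU,
    hh.submatrix _ _, fun x hx => ?_⟩
  obtain ⟨h1, h2, h3⟩ := hgh x hx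
  refine ⟨?_, ?_, ?_⟩
  · rw [Matrix.submatrix_mul_equiv, h1, Matrix.submatrix_id_id]
  · rw [← Matrix.submatrix_mul _ _ _ _ _ Function.bijective_id, h2, Matrix.submatrix_one_equiv]
  · have h4 := congrArg (Matrix.submatrix · id e) h3
    rw [Matrix.submatrix_mul _ _ _ id _ Function.bijective_id, Matrix.submatrix_id_id] at h4
    rw [h4, ← Matrix.submatrix_mul_equiv _ _ _ e]
    simp [Matrix.reindex_apply]

variable {x : Aff (Box μ × Box μ)}
  {P : Matrix (BoxBelow μ j) (Box (rows (shapeBelow τ j))) ℂ}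
  {Q : Matrix (Box (rows (shapeBelow τ j))) (BoxBelow μ j) ℂ}

/-- The matrix of the linear equations for the parameters of the next block. -/
def condMat (τ : SemistandardYoungTableau lam) (j : Fin m) (x : Aff (Box μ × Box μ))
    (Q : Matrix (Box (rows (shapeBelow τ j))) (BoxBelow μ j) ℂ) :
    Matrix (ForcedZero (shapeBelow τ j) (shapeBelow τ (j + 1)) m) (FreeIndex μ j) ℂ :=
  (Q * extMat j x).submatrix Subtype.val id

lemma condMat_mulVec (v : FreeIndex μ j → ℂ)
    (p : ForcedZero (shapeBelow τ j) (shapeBelow τ (j + 1)) m) :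
    (condMat τ j x Q *ᵥ v) p = (Q *ᵥ (extMat j x *ᵥ v)) p.1 := by
  rw [Matrix.mulVec_mulVec]
  rfl

lemma condMat_mulVec_eq_zero_iff (v : FreeIndex μ j → ℂ) : condMat τ j x Q *ᵥ v = 0 ↔
    IsGood (shapeBelow τ (j + 1)) m (Q *ᵥ (extMat j x *ᵥ v)) := by
  rw [funext_iff, Subtype.forall]
  exact forall₂_congr fun p hp => by rw [condMat_mulVec]; rfl

lemma stripBefore_shapeBelow_le (hτ : HasWeight τ μ) (r : ℕ) :
    stripBefore (shapeBelow τ j).rowLen (shapeBelow τ (j + 1)).rowLen m r ≤ μ j := by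
  rw [card_strip_shapeBelow hτ j j.2]
  exact (isHorizontalStrip_shapeBelow j.2).stripBefore_le_sum r

lemma finrank_ker_condMat (hμ : Antitone μ) (hτ : HasWeight τ μ) (hx : HasSliceShape x j)
    (hPQ : P * Q = 1) (hQP : Q * P = 1)
    (hA : block x j * P = P * jordan (rows (shapeBelow τ j))) :
    Module.finrank ℂ (LinearMap.ker (condMat τ j x Q).mulVecLin) +
      ∑ i ∈ Finset.range m, i * ((shapeBelow τ (j + 1)).rowLen i - (shapeBelow τ j).rowLen i) =
        j * μ j := by
  have hsurj : LinearMap.range (condMat τ j x Q).mulVecLin = ⊤ := by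
    rw [LinearMap.range_eq_top]
    intro z
    obtain ⟨v, hv⟩ := exists_coordinates_eq hμ hx hPQ hQP hA fun p =>
      if h : rows (shapeBelow τ j) p.1 ≤ p.2 + stripBefore (shapeBelow τ j).rowLen
        (shapeBelow τ (j + 1)).rowLen m (rows (shapeBelow τ j) p.1) then z ⟨p, h⟩ else 0
    refine ⟨v, funext fun p => ?_⟩
    rw [Matrix.mulVecLin_apply, condMat_mulVec,
      hv p.1 (p.2.trans (by gcongr; exact stripBefore_shapeBelow_le hτ _)), dif_pos p.2]
  have h := (condMat τ j x Q).mulVecLin.finrank_range_add_finrank_ker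
  rw [hsurj, finrank_top, Module.finrank_fintype_fun_eq_card, Module.finrank_fintype_fun_eq_card,
    card_freeIndex, card_forcedZero (isHorizontalStrip_shapeBelow j.2)
      ((colLen_shapeBelow_le _).trans j.2.le)] at h
  rw [← h, add_comm]

lemma truncate_mem_stage {y : Aff (Box μ × Box μ)} (hy : y ∈ stage τ μ (j + 1)) :
    truncate j y ∈ stage τ μ j := by
  refine ⟨fun p q hq => if_neg hq.not_gt, hasSliceShape_truncate hy.2.1, fun i hi => ?_⟩
  rw [block_truncate hi]
  exact hy.2.2 i (by omega)

/-- The fibres are non-empty: the coordinates that are not forced to vanish are chosen to be `1`. -/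
lemma exists_fill_mem_stage (hμ : Antitone μ) (hτ : HasWeight τ μ) (hx : x ∈ stage τ μ j) :
    ∃ v, fill j x v ∈ stage τ μ (j + 1) := by
  obtain ⟨U, P, Q, -, hxU, -, hPQ⟩ := exists_regular_jordan_conj hx
  obtain ⟨h1, h2, h3⟩ := hPQ x ⟨hx, hxU⟩
  obtain ⟨v, hv⟩ := exists_coordinates_eq hμ hx.2.1 h1 h2 h3 fun p =>
    if rows (shapeBelow τ j) p.1 ≤ p.2 + stripBefore (shapeBelow τ j).rowLen
      (shapeBelow τ (j + 1)).rowLen m (rows (shapeBelow τ j) p.1) then 0 else 1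
  refine ⟨v, (fill_mem_stage_iff hτ hx h1 h2 h3 v).2 ⟨fun p hp => ?_, ?_⟩⟩
  · rw [hv p (hp.trans (by gcongr; exact stripBefore_shapeBelow_le hτ _)), if_pos hp]
  · refine (isStripExtension_fill hτ hx h1 h2 h3 v).colTail_le_rank fun p hp hp' => ?_
    rw [hv p hp', if_neg hp.not_ge]
    exact one_ne_zero

lemma isOpen_colTail_le_rank (lam : YoungDiagram) (i : ℕ) :
    IsOpen {y : Aff (Box μ × Box μ) | ∀ r, colTail lam r ≤ (block y i ^ r).rank} := by
  -- only finitely many powers matter, because `colTail lam r` vanishes for large `r`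
  have h : {y : Aff (Box μ × Box μ) | ∀ r, colTail lam r ≤ (block y i ^ r).rank} =
      ⋂ r ∈ Finset.range (∑ i, rows lam i), {y | colTail lam r ≤ (block y i ^ r).rank} := by
    ext y
    simp only [Set.mem_ofPred_eq, Set.mem_iInter, Finset.mem_range]
    refine ⟨fun h r _ => h r, fun h r => ?_⟩
    rcases lt_or_ge r (∑ i, rows lam i) with hr | hr
    · exact h r hr
    · refine (Finset.sum_eq_zero fun k hk => ?_).trans_le (Nat.zero_le _)
      exact Nat.sub_eq_zero_of_le ((Finset.single_le_sum (fun _ _ => Nat.zero_le _) hk).trans hr)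
  rw [h]
  exact isOpen_biInter_finset fun r _ => isOpen_le_rank ((regularMatOn_block i).pow r) _

/-- Adding a letter to the tableau amounts to passing to an open subset of a vector bundle. -/
theorem isLocallyOpenInBundle_stage (hμ : Antitone μ) (hτ : HasWeight τ μ)
    (hne : (stage τ μ j).Nonempty) :
    ∃ e, IsLocallyOpenInBundle (stage τ μ j) (stage τ μ (j + 1)) (truncate j) e ∧
      e + ∑ i ∈ Finset.range m, i * ((shapeBelow τ (j + 1)).rowLen i -
        (shapeBelow τ j).rowLen i) = j * μ j := by
  set n := ∑ i ∈ Finset.range m, i * ((shapeBelow τ (j + 1)).rowLen i -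
    (shapeBelow τ j).rowLen i) with hn
  have hle : n ≤ j * μ j := by
    obtain ⟨x, hx⟩ := hne
    obtain ⟨U, P, Q, -, hxU, -, hPQ⟩ := exists_regular_jordan_conj hx
    obtain ⟨h1, h2, h3⟩ := hPQ x ⟨hx, hxU⟩
    rw [← finrank_ker_condMat hμ hτ hx.2.1 h1 h2 h3]
    exact Nat.le_add_left _ _
  refine ⟨j * μ j - n, ⟨regularMapOn_truncate j, fun y hy => truncate_mem_stage hy, fun x hx => ?_,
    {y | ∀ r, colTail (shapeBelow τ (j + 1)) r ≤ (block y (j + 1) ^ r).rank},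
    isOpen_colTail_le_rank _ _, fun y hy r => (mem_orbit_iff.1 (hy.2.2 _ le_rfl) r).ge,
    fun x₀ hx₀ => ?_⟩, Nat.sub_add_cancel hle⟩
  · obtain ⟨v, hv⟩ := exists_fill_mem_stage hμ hτ hx
    exact ⟨_, hv, truncate_fill hx.1⟩
  obtain ⟨U₁, P, Q, hU₁, hxU₁, hQ, hPQ⟩ := exists_regular_jordan_conj hx₀
  have hM : RegularMatOn (stage τ μ j ∩ U₁) fun x => condMat τ j x (Q x) :=
    (hQ.mul regularMatOn_extMat).submatrix _ _
  obtain ⟨U₂, K, R, hU₂, hxU₂, hK, hKR⟩ := exists_regular_kernel_basis hM (e := j * μ j - n)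
    (fun x hx => by
      obtain ⟨h1, h2, h3⟩ := hPQ x hx
      rw [← finrank_ker_condMat hμ hτ hx.1.2.1 h1 h2 h3, Nat.add_sub_cancel]) ⟨hx₀, hxU₁⟩
  have hmem : ∀ x ∈ stage τ μ j ∩ (U₁ ∩ U₂), x ∈ stage τ μ j ∩ U₁ ∩ U₂ := fun x hx =>
    ⟨⟨hx.1, hx.2.1⟩, hx.2.2⟩
  refine ⟨U₁ ∩ U₂, Fin (j * μ j - n), inferInstance, fun x w => fill j x (K x *ᵥ w.toFun),
    fun y => ⟨R *ᵥ (param j y).toFun⟩, hU₁.inter hU₂, ⟨hxU₁, hxU₂⟩, Fintype.card_fin _, ?_, ?_, ?_,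
    ?_⟩
  · refine RegularMapOn.fill (F := Aff.fst) (G := fun z => ⟨K z.fst *ᵥ z.snd.toFun⟩)
      RegularMapOn.fst (RegularMapOn.mulVec (M := fun z => K z.fst) ?_ RegularMapOn.snd)
    exact fun p q => (hK p q).comp RegularMapOn.fst fun z hz => hmem _ hz
  · exact RegularMapOn.mulVec (RegularMatOn.const R) regularMapOn_param
  · intro x hx w
    obtain ⟨h1, h2, h3⟩ := hPQ x ⟨hx.1, hx.2.1⟩
    obtain ⟨h4, h5, -⟩ := hKR x (hmem x hx)
    refine ⟨truncate_fill hx.1.1, ?_, fun hO => ?_⟩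
    · simp only [param_fill hμ, Matrix.mulVec_mulVec, h5, Matrix.one_mulVec]
    · refine (fill_mem_stage_iff hτ hx.1 h1 h2 h3 _).2 ⟨?_, hO⟩
      rw [← condMat_mulVec_eq_zero_iff, Matrix.mulVec_mulVec, h4, Matrix.zero_mulVec]
  · intro y hy hyU
    have hx := truncate_mem_stage hy
    have hfill := fill_truncate_param hy.2.1 hy.1
    obtain ⟨h1, h2, h3⟩ := hPQ _ ⟨hx, hyU.1⟩
    have hgood := ((fill_mem_stage_iff hτ hx h1 h2 h3 (param j y).toFun).1 (by rwa [hfill])).1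
    rw [← condMat_mulVec_eq_zero_iff] at hgood
    simp only [(hKR _ (hmem _ ⟨hx, hyU⟩)).2.2 _ hgood, hfill]

lemma block_zero_mem_orbit (x : Aff (Box μ × Box μ)) :
    block x 0 ∈ orbit (BoxBelow μ 0) (shapeBelow τ 0) := by
  have : IsEmpty (BoxBelow μ 0) := ⟨fun p => Nat.not_lt_zero _ p.2⟩
  rw [mem_orbit_iff]
  intro r
  rw [colTail_eq (colLen_shapeBelow_le 0)]
  exact Nat.le_zero.1 ((Matrix.rank_le_card_width _).trans_eq (by simp))

/-- The varieties of the parts of a tableau are irreducible, and covered by affine charts. -/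
theorem exists_dim_stage (hμ : Antitone μ) (hτ : HasWeight τ μ) {k : ℕ} (hk : k ≤ m) :
    ∃ d, LocallyAffine (stage τ μ k) d ∧ IsIrreducible (stage τ μ k) ∧
      d + ∑ i ∈ Finset.range m, i * (shapeBelow τ k).rowLen i =
        ∑ i : Fin m, if (i : ℕ) < k then i * μ i else 0 := by
  induction k with
  | zero =>
    have hX : stage τ μ 0 = {⟨fun _ => 0⟩} := by
      ext x
      rw [Set.mem_singleton_iff]
      refine ⟨fun h => ?_, ?_⟩
      · ext ⟨p, q⟩
        exact h.1 p q (Nat.zero_le _)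
      · rintro rfl
        refine ⟨fun _ _ _ => rfl, fun _ _ h => absurd h (Nat.not_lt_zero _), fun i hi => ?_⟩
        rw [Nat.le_zero.1 hi]
        exact block_zero_mem_orbit _
    refine ⟨0, fun x hx => ?_, ?_, ?_⟩
    · refine ⟨Empty, inferInstance, Set.univ, Set.univ, fun _ => ⟨fun _ => 0⟩,
        fun _ => ⟨fun _ => 0⟩, by simp, isOpen_univ, trivial, isOpen_univ, RegularMapOn.const _,
        RegularMapOn.const _, fun _ _ => trivial, fun _ _ => ?_, fun y hy => ?_, fun y _ => ?_⟩
      · simp [hX]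
      · rw [hX] at hy
        exact hy.1.symm
      · ext i
        exact i.elim
    · rw [hX]
      exact isIrreducible_singleton
    · simp [rowLen_shapeBelow_eq_zero]
  | succ k ih =>
    obtain ⟨d, h1, h2, h3⟩ := ih (by omega)
    let j : Fin m := ⟨k, hk⟩
    obtain ⟨e, he, hed⟩ := isLocallyOpenInBundle_stage (j := j) hμ hτ h2.nonempty
    refine ⟨d + e, h1.of_isLocallyOpenInBundle he, isIrreducible_of_isLocallyOpenInBundle h2 he, ?_⟩
    have hle := (isHorizontalStrip_shapeBelow (τ := τ) hk).le
    have hsum : ∑ i ∈ Finset.range m, i * (shapeBelow τ (k + 1)).rowLen i =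
        ∑ i ∈ Finset.range m, i * (shapeBelow τ k).rowLen i +
          ∑ i ∈ Finset.range m, i * ((shapeBelow τ (k + 1)).rowLen i -
            (shapeBelow τ k).rowLen i) := by
      rw [← Finset.sum_add_distrib]
      refine Finset.sum_congr rfl fun i _ => ?_
      rw [← mul_add, Nat.add_sub_cancel' (hle i)]
    have hsum' : (∑ i : Fin m, if (i : ℕ) < k + 1 then i * μ i else 0) =
        (∑ i : Fin m, if (i : ℕ) < k then i * μ i else 0) + j * μ j := by
      rw [← Fintype.sum_ite_eq' j fun i => (i : ℕ) * μ i, ← Finset.sum_add_distrib]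
      refine Finset.sum_congr rfl fun i _ => ?_
      have : i = j ↔ (i : ℕ) = k := Fin.ext_iff
      by_cases h : (i : ℕ) = k
      · simp [this, h]
      · have : (i : ℕ) < k + 1 ↔ (i : ℕ) < k := by omega
        simp [*]
    rw [hsum, hsum', ← h3, ← hed]
    ring

end Step

/-! ### The variety of a tableau -/

section Variety

/-- A square matrix as a point of affine space. -/
def toAff {n : Type} (A : Matrix n n ℂ) : Aff (n × n) := ⟨fun e => A e.1 e.2⟩

lemma isInducing_toAff (n : Type) :
    @IsInducing _ _ (zariskiTopology n) _ (toAff : Matrix n n ℂ → Aff (n × n)) := by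
  let _ := zariskiTopology n
  refine ⟨TopologicalSpace.ext_iff_isClosed.2 fun Z => ?_⟩
  rw [isClosed_induced_iff]
  have hcl : IsClosed[zariskiTopology n] Z ↔ ∃ S : Set (MvPolynomial (n × n) ℂ),
      Z = {A | ∀ f ∈ S, ev f (toAff A) = 0} := by
    rw [← isOpen_compl_iff]
    change Zᶜᶜ ∈ _ ↔ _
    rw [compl_compl]
    rfl
  rw [hcl]
  constructor
  · rintro ⟨S, rfl⟩
    refine ⟨{x | ∀ f ∈ S, ev f x = 0}, ?_, rfl⟩
    rw [← isOpen_compl_iff, isOpen_iff_ev]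
    intro x hx
    obtain ⟨f, hf, hfx⟩ : ∃ f ∈ S, ev f x ≠ 0 := by simpa using hx
    exact ⟨f, hfx, fun y hy hy' => hy (hy' f hf)⟩
  · rintro ⟨C, hC, rfl⟩
    refine ⟨{f | ∀ x ∈ C, ev f x = 0}, Set.ext fun A => ⟨fun hA f hf => hf _ hA, fun hA => ?_⟩⟩
    by_contra hAC
    obtain ⟨f, hf, hfC⟩ := isOpen_iff_ev.1 hC.isOpen_compl _ hAC
    exact hf (hA f fun x hx => not_not.1 fun h => hfC x h hx)

lemma submatrix_mem_orbit_iff {n n' : Type} [Fintype n] [DecidableEq n] [Fintype n']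
    [DecidableEq n'] (e : n' ≃ n) {A : Matrix n n ℂ} {lam : YoungDiagram} :
    A.submatrix e e ∈ orbit n' lam ↔ A ∈ orbit n lam := by
  rw [mem_orbit_iff, mem_orbit_iff]
  refine forall_congr' fun r => ?_
  have h : A.submatrix e e ^ r = (A ^ r).submatrix e e := by
    induction r with
    | zero => simp
    | succ r ih => rw [pow_succ, pow_succ, ih, Matrix.submatrix_mul_equiv]
  rw [h, Matrix.rank_submatrix]

variable {m : ℕ} {μ : Fin m → ℕ} {lam : YoungDiagram} {τ : SemistandardYoungTableau lam}

lemma restrict_mem_orbit_iff {A : Matrix (Box μ) (Box μ) ℂ} (i : Fin m) :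
    restrict A i ∈ orbit {p : Box μ // p.1 ≤ i} (shapeUpTo τ i) ↔
      block (toAff A) (i + 1) ∈ orbit (BoxBelow μ (i + 1)) (shapeBelow τ (i + 1)) := by
  let e : BoxBelow μ (i + 1) ≃ {p : Box μ // p.1 ≤ i} :=
    Equiv.subtypeEquivRight fun p => Nat.lt_succ_iff
  exact (submatrix_mem_orbit_iff e).symm

/-- At most one diagonal entry in each block can be nonzero, that in the last row; it vanishes
because the top left submatrices are nilpotent and so have trace zero. -/
lemma diag_eq_zero {A : Matrix (Box μ) (Box μ) ℂ} (hA : A ∈ tableauSet τ μ) (p : Box μ) :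
    A p p = 0 := by
  obtain ⟨⟨⟨T, rfl, hT⟩, -⟩, horb⟩ := hA
  have hnot : ∀ q : Box μ, (q.2 : ℕ) + 1 ≠ μ q.1 → (jordan μ + T) q q = 0 := fun q hq => by
    rw [Matrix.add_apply, hT q q fun h => hq h.1, jordan, if_neg (by simp), add_zero]
  induction hn : (p.1 : ℕ) using Nat.strong_induction_on generalizing p with
  | _ n ih =>
  subst hn
  by_cases hp : (p.2 : ℕ) + 1 = μ p.1
  · have h1 := (Matrix.isNilpotent_trace_of_isNilpotent
      (isNilpotent_of_rank (mem_orbit_iff.1 (horb p.1)))).eq_zero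
    rw [Matrix.trace, Finset.sum_eq_single ⟨p, le_rfl⟩] at h1
    · exact h1
    · rintro ⟨q, hq⟩ - hne
      rcases hq.lt_or_eq with hlt | heq
      · exact ih _ hlt q rfl
      · exact hnot q fun h => hne (Subtype.ext (last_unique heq h hp))
    · simp
  · exact hnot p hp

lemma toAff_mem_stage_iff (hμ : Antitone μ) {A : Matrix (Box μ) (Box μ) ℂ} :
    toAff A ∈ stage τ μ m ↔ A ∈ tableauSet τ μ := by
  constructor
  · rintro ⟨-, hA, horb⟩
    have hA' : ∀ p q : Box μ, ¬ IsFree p q → A p q = jordan μ p q := fun p q => hA p q q.1.2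
    refine ⟨⟨⟨A - jordan μ, by simp, fun p q hpq => ?_⟩, fun p q hpq => ?_⟩, fun i =>
      (restrict_mem_orbit_iff i).2 (horb _ i.2)⟩
    · rw [Matrix.sub_apply, hA' p q fun h => hpq ⟨h.2, lt_min (q.2.2.trans_le (hμ h.1.le)) q.2.2⟩,
        sub_self]
    · rw [hA' p q fun h => ?_, jordan, if_neg]
      · rintro ⟨h1, h2⟩
        rcases hpq with h | h
        · exact h.ne h1.symm
        · omega
      · rcases hpq with h' | h'
        · exact lt_asymm h.1 h'
        · exact h.1.ne h'.1.symm
  · intro hA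
    have hdiag := diag_eq_zero hA
    obtain ⟨⟨⟨T, hAT, hT⟩, hup⟩, horb⟩ := hA
    refine ⟨fun p q h => absurd q.1.2 h.not_gt, fun p q _ hpq => ?_, fun i hi => ?_⟩
    · change A p q = _
      by_cases hlast : (p.2 : ℕ) + 1 = μ p.1
      · -- the position is on or below the diagonal, or to the left of it in a diagonal block
        have hle : q.1 ≤ p.1 := not_lt.1 fun h => hpq ⟨h, hlast⟩
        have hjor : jordan μ p q = 0 := by
          refine if_neg ?_
          rintro ⟨h1, h2⟩
          have h3 : (q.2 : ℕ) < μ p.1 := q.2.2.trans_eq (congrArg μ h1.symm)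
          omega
        rw [hjor]
        rcases hle.lt_or_eq with hlt | heq
        · exact hup p q (.inl hlt)
        · by_cases hq : (q.2 : ℕ) + 1 = μ q.1
          · rw [last_unique heq hq hlast]
            exact hdiag p
          · refine hup p q (.inr ⟨heq, ?_⟩)
            have h3 : (q.2 : ℕ) < μ p.1 := q.2.2.trans_eq (congrArg μ heq)
            have h4 := congrArg μ heq
            omega
      · rw [hAT, Matrix.add_apply, hT p q fun h => hlast h.1, add_zero]
    · cases i with
      | zero => exact block_zero_mem_orbit _
      | succ i => exact (restrict_mem_orbit_iff ⟨i, hi⟩).1 (horb ⟨i, hi⟩)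

/-- The variety of a tableau, as a subset of affine space. -/
noncomputable def tableauVarietyHomeomorph (hμ : Antitone μ) (τ : SemistandardYoungTableau lam) :
    TableauVariety τ μ ≃ₜ stage τ μ m :=
  Equiv.toHomeomorphOfIsInducing
    (X := TableauVariety τ μ) (Y := stage τ μ m)
    { toFun := fun A => ⟨toAff A.1, (toAff_mem_stage_iff hμ).2 A.2⟩
      invFun := fun x => ⟨fun p q => x.1 (p, q), (toAff_mem_stage_iff hμ).1 x.2⟩
      left_inv := fun _ => rfl
      right_inv := fun _ => rfl }
    (by
      let _ := zariskiTopology (Box μ)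
      have h : IsInducing (fun A : TableauVariety τ μ => toAff A.1) :=
        (isInducing_toAff _).comp ⟨rfl⟩
      exact (IsInducing.subtypeVal.of_comp_iff).1 h)

lemma sum_rowLen_eq (hτ : HasWeight τ μ) : ∑ i : Fin m, lam.rowLen i = ∑ i, μ i := by
  have hcol : lam.colLen 0 ≤ m := by
    have := colLen_shapeBelow_le (τ := τ) m
    rwa [shapeBelow_eq hτ] at this
  rw [← Finset.sum_range, ← card_cells_eq_sum hcol,
    Finset.card_eq_sum_card_fiberwise (f := fun c => τ c.1 c.2) (t := Finset.range m)
      fun c hc => Finset.mem_coe.2 (Finset.mem_range.2 (hτ.1 c hc)), Finset.sum_range]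
  exact Finset.sum_congr rfl fun i _ => hτ.2 i

lemma pairing_eq (hτ : HasWeight τ μ) {d : ℕ}
    (hd : d + ∑ i ∈ Finset.range m, i * lam.rowLen i = ∑ i : Fin m, i * μ i) :
    (d : ℤ) = pairing lam μ := by
  have h1 : (∑ i : Fin m, (lam.rowLen i : ℤ)) = ∑ i, (μ i : ℤ) := by
    exact_mod_cast sum_rowLen_eq hτ
  have h2 : (d : ℤ) + ∑ i : Fin m, (i : ℤ) * lam.rowLen i = ∑ i : Fin m, (i : ℤ) * μ i := by
    rw [Finset.sum_range] at hd
    exact_mod_cast hd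
  have h3 : pairing lam μ = m * (∑ i : Fin m, (lam.rowLen i : ℤ) - ∑ i, (μ i : ℤ)) -
      (∑ i : Fin m, (i : ℤ) * lam.rowLen i - ∑ i : Fin m, (i : ℤ) * μ i) := by
    rw [← Finset.sum_sub_distrib, ← Finset.sum_sub_distrib, Finset.mul_sum,
      ← Finset.sum_sub_distrib]
    refine Finset.sum_congr rfl fun i _ => ?_
    rw [rho]
    ring
  rw [h3, h1]
  linarith

/-- The variety of a tableau is irreducible, of dimension `⟨λ - μ, ρ⟩`. -/
theorem exists_dim_tableauVariety (hμ : Antitone μ) (hτ : HasWeight τ μ) :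
    ∃ d : ℕ, (d : ℤ) = pairing lam μ ∧ IrreducibleSpace (TableauVariety τ μ) ∧
      topologicalKrullDim (TableauVariety τ μ) = d := by
  obtain ⟨d, haff, hirr, hd⟩ := exists_dim_stage hμ hτ le_rfl
  have := Subtype.irreducibleSpace hirr
  let Φ := tableauVarietyHomeomorph hμ τ
  refine ⟨d, pairing_eq hτ ?_, ?_, ?_⟩
  · simpa [shapeBelow_eq hτ] using hd
  · have h := (IrreducibleSpace.isIrreducible_univ (stage τ μ m)).image Φ.symm
      Φ.symm.continuous.continuousOn
    rw [Set.image_univ, Φ.symm.surjective.range_eq] at h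
    exact (irreducibleSpace_def _).2 h
  · rw [IsHomeomorph.topologicalKrullDim_eq Φ Φ.isHomeomorph]
    exact haff.topologicalKrullDim_eq hirr.nonempty

end Variety

end MVSlice

theorem mainTheorem3 (lam : YoungDiagram) (m : ℕ) (μ : Fin m → ℕ) (hμ : Antitone μ)
    (τ : SemistandardYoungTableau lam) (hτ : MVSlice.HasWeight τ μ) :
    ∃ d : ℕ, (d : ℤ) = MVSlice.pairing lam μ ∧
      ∃ Z ∈ irreducibleComponents (MVSlice.TableauVariety τ μ),
        topologicalKrullDim Z = (d : WithBot ℕ∞) ∧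
        ∀ Z' ∈ irreducibleComponents (MVSlice.TableauVariety τ μ),
          Z' ≠ Z → topologicalKrullDim Z' < (d : WithBot ℕ∞) := by
  obtain ⟨d, hd, hirr, hdim⟩ := MVSlice.exists_dim_tableauVariety hμ hτ
  rw [irreducibleComponents_eq_singleton]
  refine ⟨d, hd, Set.univ, rfl, ?_, fun Z' hZ' hne => absurd hZ' hne⟩
  rw [← hdim]
  exact IsHomeomorph.topologicalKrullDim_eq _ (Homeomorph.Set.univ _).isHomeomorph
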